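/- Let $P$ be a plain (non-symmetric) operad in sets, with unit $1_P\in P_1$. Let $F(P)$ be the free plain operad on the family of sets $(P_n)_{n\in\mathbb N}$ (its operations are trees with vertices labelled by operations of $P$) and let $\varepsilon : F(P)\to P$ be evaluation. The *weakening* $\mathrm{Wk}(P)$ is the $\mathbf{Cat}$-enriched operad whose 1-cells are the operations of $F(P)$, with exactly one 2-cell $q\to q'$ if $\varepsilon(q)=\varepsilon(q')$, and none otherwise. Each $p\in P_n$ is regarded as a 1-cell $p$ of $\mathrm{Wk}(P)$ (the tree with one vertex labelled $p$). A *weak $P$-category* is a small category $A$ with a (strict) action of $\mathrm{Wk}(P)$: functors $\mathrm{Wk}(P)_n\times A^n\to A$, written $(q,a_1,\dots,a_n)\mapsto q(a_1,\dots,a_n)$, compatible with the unit and composition. A *weak $P$-functor* $(G,\gamma):A\to B$ is a functor $G$ with isomorphisms $\gamma_{q}:q(Ga_1,\dots,Ga_n)\to G(q(a_1,\dots,a_n))$, natural in $q\in\mathrm{Wk}(P)_n$ and in $a_1,\dots,a_n$, and compatible with the unit and composition of $\mathrm{Wk}(P)$; it is *strict* if every $\gamma_q$ is an identity. A *$P$-transformation*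 is a natural transformation commuting with these isomorphisms. These form a 2-category $\mathbf{Wk}\text{-}P\text{-}\mathbf{Cat}$. A *strict $P$-category* is a small category with a strict action of $P$ (with each $P_n$ regarded as a discrete category); it becomes a weak $P$-category by restricting the action along $\varepsilon$. Strict $P$-categories, strict $P$-functors and all $P$-transformations between them form a 2-category $\mathbf{Str}\text{-}P\text{-}\mathbf{Cat}$, with a 2-functor $U':\mathbf{Str}\text{-}P\text{-}\mathbf{Cat}\to\mathbf{Wk}\text{-}P\text{-}\mathbf{Cat}$. For a weak $P$-category $A$, its *strictification* $\mathbf{st}\,A$ is the strict $P$-category whose objects are the tuples $(p,a_1,\dots,a_n)$ with $n\ge 0$, $p\in P_n$ and $a_i\in A$, whose arrows $(p,a_\bullet)\to(p',a'_\bullet)$ are the arrows $p(a_\bullet)\to p'(a'_\bullet)$ of $A$ (with the composition of $A$), and on which $P$ acts on objects by $p\cdot\big((p_1,a^1_\bullet),\dots,(p_n,a^n_\bullet)\big)=(p\circ(p_1,\dots,p_n),a^1_\bullet\cdots a^n_\bullet)$, and on arrows by sending $(f_i)_i$ to $\delta\circ p(f_1,\dots,f_n)\circ\delta^{-1}$,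 where throughout $\delta$ denotes the component of the appropriate unique 2-cell of $\mathrm{Wk}(P)$. Let $(F,\phi):U'\mathbf{st}\,A\to A$ be given by $F(p,a_\bullet)=p(a_\bullet)$, the identity on arrows, and $\phi=\delta$. Let $(F',\psi):A\to U'\mathbf{st}\,A$ be given as follows: $F'(a)=(1_P,a)$; $F'(f)$ is the arrow $(1_P,a)\to(1_P,a')$ given by the arrow $1_P(f)$ of $A$; and $\psi_q$, for $q\in\mathrm{Wk}(P)_n$, is the arrow $(\varepsilon(q),a_\bullet)\to(1_P,q(a_\bullet))$ given by the component $\varepsilon(q)(a_\bullet)\to 1_P(q(a_\bullet))$ of the 2-cell of $\mathrm{Wk}(P)$. These are weak $P$-functors. **Theorem.** 1. The assignment $A\mapsto\mathbf{st}\,A$ extends to a functor $\mathbf{st}:\mathbf{Wk}\text{-}P\text{-}\mathbf{Cat}\to\mathbf{Str}\text{-}P\text{-}\mathbf{Cat}$ of 1-categories which is left adjoint to the (1-categorical) forgetful functor $U'$, in such a way that the component of the unit at each $A$ is $(F',\psi):A\to U'\mathbf{st}\,A$. 2. For each weak $P$-category $A$, the weak $P$-functors $(F',\psi)$ and $(F,\phi)$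 are pseudo-inverse to each other, i.e. they form an (adjoint) equivalence between $A$ and $U'\mathbf{st}\,A$ in the 2-category $\mathbf{Wk}\text{-}P\text{-}\mathbf{Cat}$. 3. Consequently $\mathbf{Str}\text{-}P\text{-}\mathbf{Cat}$ is a weakly coreflective sub-2-category of $\mathbf{Wk}\text{-}P\text{-}\mathbf{Cat}$; that is, $U'$ is injective on objects, 1-cells and 2-cells, and on underlying 1-categories it has a left adjoint such that every component of the unit is an equivalence in the 2-category $\mathbf{Wk}\text{-}P\text{-}\mathbf{Cat}$. -/

import Mathlib

open CategoryTheory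

universe v u w w' w₁ w₁'

namespace OperadCoherence

/-- The position of the `j`-th entry of the `i`-th block when `n` blocks of lengths
`k 0, …, k (n - 1)` are concatenated into one list of length `∑ i, k i`. -/
def idx {n : ℕ} {k : Fin n → ℕ} (i : Fin n) (j : Fin (k i)) : Fin (∑ i, k i) :=
  finSigmaFinEquiv ⟨i, j⟩

/-- A plain (non-symmetric) operad in sets. -/
structure PlainOperad where
  Op : ℕ → Type u
  one : Op 1
  comp : ∀ {n : ℕ} {k : Fin n → ℕ}, Op n → (∀ i, Op (k i)) → Op (∑ i, k i)
  one_comp : ∀ {n : ℕ} (p : Op n), HEq (comp (k := fun _ : Fin 1 => n) one (fun _ => p)) p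
  comp_one : ∀ {n : ℕ} (p : Op n), HEq (comp (k := fun _ : Fin n => 1) p (fun _ => one)) p
  assoc : ∀ {n : ℕ} {k : Fin n → ℕ} {l : Fin (∑ i, k i) → ℕ}
    (p : Op n) (q : ∀ i, Op (k i)) (r : ∀ m, Op (l m)),
    HEq (comp (k := fun i => ∑ j, l (idx i j)) p
          (fun i => comp (k := fun j => l (idx i j)) (q i) (fun j => r (idx i j))))
        (comp (comp p q) r)

theorem idx_val {n : ℕ} {k : Fin n → ℕ} (i : Fin n) (j : Fin (k i)) :
    (idx i j : ℕ) = ∑ a : Fin i.1, k (Fin.castLE i.2.le a) + j :=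
  finSigmaFinEquiv_apply ⟨i, j⟩

theorem idx_surj {n : ℕ} {k : Fin n → ℕ} (m : Fin (∑ i, k i)) :
    ∃ i, ∃ j : Fin (k i), idx i j = m :=
  ⟨_, _, finSigmaFinEquiv.apply_symm_apply m⟩

theorem sum_idx {M : Type*} [AddCommMonoid M] {n : ℕ} {k : Fin n → ℕ}
    (l : Fin (∑ i, k i) → M) : ∑ m, l m = ∑ i, ∑ j, l (idx i j) := by
  rw [← Equiv.sum_comp finSigmaFinEquiv l, Fintype.sum_sigma]
  rfl

theorem idx_val' {n : ℕ} {k : Fin n → ℕ} (i : Fin n) (j : Fin (k i)) :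
    (idx i j : ℕ) = (∑ a, if a < i then k a else 0) + j := by
  rw [idx, finSigmaFinEquiv_apply, ← Finset.sum_filter]
  congr 1
  refine Finset.sum_bij (fun a _ => Fin.castLE i.2.le a) ?_ ?_ ?_ ?_
  · intro a _
    exact Finset.mem_filter.2 ⟨Finset.mem_univ _, a.2⟩
  · intro a _ b _ h
    simpa [Fin.ext_iff] using h
  · intro b hb
    exact ⟨⟨b, (Finset.mem_filter.1 hb).2⟩, by simp, by simp⟩
  · intro a _
    rfl

theorem idx_lt {n : ℕ} {k : Fin n → ℕ} {i i' : Fin n} (h : i < i') (j : Fin (k i))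
    (j' : Fin (k i')) : idx i j < idx i' j' := by
  rw [Fin.lt_def, idx_val', idx_val']
  have : (∑ a, if a < i then k a else 0) + k i ≤ ∑ a, if a < i' then k a else 0 := by
    have h2 : k i = ∑ a, if a = i then k a else 0 := by simp
    rw [h2, ← Finset.sum_add_distrib]
    refine Finset.sum_le_sum (fun a _ => ?_)
    by_cases h1 : a < i
    · simp [h1, h1.ne, h1.trans h]
    · by_cases h3 : a = i
      · subst h3; simp [h]
      · simp [h1, h3]
  omega

theorem idx_assoc {n : ℕ} {k : Fin n → ℕ} {l : Fin (∑ i, k i) → ℕ} (i : Fin n) (j : Fin (k i))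
    (m : Fin (l (idx i j))) :
    (idx (k := l) (idx i j) m : ℕ) =
      (idx (k := fun i => ∑ j, l (idx i j)) i (idx (k := fun j => l (idx i j)) j m) : ℕ) := by
  rw [idx_val', idx_val', idx_val', sum_idx, ← add_assoc]
  congr 1
  have h2 : (∑ b, if b < j then l (idx i b) else 0)
      = ∑ a, if a = i then (∑ b, if b < j then l (idx i b) else 0) else 0 := by simp
  rw [h2, ← Finset.sum_add_distrib]
  refine Finset.sum_congr rfl (fun a _ => ?_)
  rcases lt_trichotomy a i with h | h | h
  · simp [h, h.ne, idx_lt h]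
  · subst h
    simp only [lt_irrefl, if_false, if_true, zero_add]
    refine Finset.sum_congr rfl (fun b _ => ?_)
    congr 1
    rw [Fin.lt_def, Fin.lt_def, idx_val', idx_val', add_lt_add_iff_left]
  · simp [h.ne', h.not_gt, (idx_lt h _ _).not_gt]

/-- Strongly regular trees with `n` leaves whose vertices are labelled by the signature `Φ`. -/
inductive Tree (Φ : ℕ → Type u) : ℕ → Type u
  | leaf : Tree Φ 1
  | node {n : ℕ} {k : Fin n → ℕ} (φ : Φ n) (τ : ∀ i, Tree Φ (k i)) : Tree Φ (∑ i, k i)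

namespace Tree

variable {Φ : ℕ → Type u}

/-- Grafting of trees: the composition of the free plain operad on `Φ`. -/
def graft : ∀ {n : ℕ}, Tree Φ n → ∀ {k : Fin n → ℕ}, (∀ i, Tree Φ (k i)) → Tree Φ (∑ i, k i)
  | _, leaf, k, σ => cast (congrArg (Tree Φ) (Fin.sum_univ_one k).symm) (σ 0)
  | _, node φ τ, l, σ =>
      cast (congrArg (Tree Φ) (sum_idx l).symm)
        (node (k := fun i => ∑ j, l (idx i j)) φ
          (fun i => graft (k := fun j => l (idx i j)) (τ i) (fun j => σ (idx i j))))

theorem graft_congr {n n' : ℕ} {k : Fin n → ℕ} {k' : Fin n' → ℕ} {t : Tree Φ n} {t' : Tree Φ n'}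
    {σ : ∀ i, Tree Φ (k i)} {σ' : ∀ i, Tree Φ (k' i)} (hn : n = n') (ht : HEq t t')
    (hk : ∀ i : Fin n, k i = k' (Fin.cast hn i))
    (hσ : ∀ i : Fin n, HEq (σ i) (σ' (Fin.cast hn i))) : HEq (graft t σ) (graft t' σ') := by
  subst hn
  obtain rfl : k = k' := funext hk
  obtain rfl : σ = σ' := funext fun i => eq_of_heq (hσ i)
  rw [eq_of_heq ht]

theorem node_congr {n : ℕ} {k k' : Fin n → ℕ} {φ : Φ n}
    {σ : ∀ i, Tree Φ (k i)} {σ' : ∀ i, Tree Φ (k' i)}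
    (hk : ∀ i : Fin n, k i = k' i)
    (hσ : ∀ i : Fin n, HEq (σ i) (σ' i)) : HEq (node φ σ) (node φ σ') := by
  obtain rfl : k = k' := funext hk
  obtain rfl : σ = σ' := funext fun i => eq_of_heq (hσ i)
  rfl

theorem fam_heq {β : ℕ → Type w} {n : ℕ} {k : Fin n → ℕ} (r : ∀ i, β (k i)) {i j : Fin n}
    (h : (i : ℕ) = j) : HEq (r i) (r j) := by
  obtain rfl : i = j := Fin.ext h
  rfl

theorem leaf_graft {n : ℕ} (t : Tree Φ n) :
    HEq (graft (k := fun _ : Fin 1 => n) leaf (fun _ => t)) t := by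
  rw [graft]; exact cast_heq _ _

theorem graft_leaf : ∀ {n : ℕ} (t : Tree Φ n),
    HEq (graft (k := fun _ : Fin n => 1) t (fun _ => leaf)) t
  | _, leaf => leaf_graft _
  | _, node φ τ => by
    rw [graft]
    refine (cast_heq _ _).trans (node_congr (fun i => by simp) fun i => graft_leaf (τ i))

theorem graft_assoc : ∀ {n : ℕ} (p : Tree Φ n) {k : Fin n → ℕ} {l : Fin (∑ i, k i) → ℕ}
    (q : ∀ i, Tree Φ (k i)) (r : ∀ m, Tree Φ (l m)),
    HEq (graft (k := fun i => ∑ j, l (idx i j)) p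
          (fun i => graft (k := fun j => l (idx i j)) (q i) (fun j => r (idx i j))))
        (graft (graft p q) r)
  | _, leaf, k, l, q, r => by
    rw [graft, graft]
    refine (cast_heq _ _).trans (graft_congr (Fin.sum_univ_one k).symm (cast_heq _ _).symm ?_ ?_)
    · intro i; congr 1; ext; simp [idx_val']
    · intro i; exact fam_heq r (by simp [idx_val'])
  | _, node φ τ, k, l, q, r => by
    have e := sum_idx k
    have h1 : HEq (graft (graft (node φ τ) q) r)
      (graft (k := fun m => l (Fin.cast e.symm m)) (node (k := fun i => ∑ j, k (idx i j)) φ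
          (fun i => graft (k := fun j => k (idx i j)) (τ i) (fun j => q (idx i j))))
          (fun m => r (Fin.cast e.symm m))) := by
      refine graft_congr e ?_ (fun _ => rfl) (fun _ => HEq.rfl)
      rw [graft]
      exact cast_heq _ _
    refine HEq.trans ?_ h1.symm
    rw [graft, graft]
    refine (cast_heq _ _).trans (HEq.trans ?_ (cast_heq _ _).symm)
    refine node_congr ?_ ?_
    · intro i
      rw [sum_idx]
      refine Finset.sum_congr rfl fun a _ => Finset.sum_congr rfl fun b _ => ?_
      congr 1; ext; simp [idx_assoc]
    · intro i
      refine HEq.trans ?_ (graft_assoc (τ i) _ _)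
      refine graft_congr rfl HEq.rfl ?_ ?_
      · intro a
        refine Finset.sum_congr rfl fun b _ => ?_
        congr 1; ext; simp [idx_assoc]
      · intro a
        refine graft_congr rfl HEq.rfl ?_ ?_
        · intro b
          congr 1; ext; simp [idx_assoc]
        · intro b
          exact fam_heq r (by simp [idx_assoc])

/-- The tree `φ ∘ (|, …, |)` with one vertex, with its arity rewritten from `1 + ⋯ + 1` to `n`. -/
def corolla {n : ℕ} (φ : Φ n) : Tree Φ n :=
  cast (congrArg (Tree Φ) (by simp)) (node (k := fun _ => 1) φ (fun _ => leaf))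

end Tree

theorem PlainOperad.comp_congr (P : PlainOperad.{u}) {n n' : ℕ} {k : Fin n → ℕ} {k' : Fin n' → ℕ}
    {t : P.Op n} {t' : P.Op n'}
    {σ : ∀ i, P.Op (k i)} {σ' : ∀ i, P.Op (k' i)} (hn : n = n') (ht : HEq t t')
    (hk : ∀ i : Fin n, k i = k' (Fin.cast hn i))
    (hσ : ∀ i : Fin n, HEq (σ i) (σ' (Fin.cast hn i))) : HEq (P.comp t σ) (P.comp t' σ') := by
  subst hn
  obtain rfl : k = k' := funext hk
  obtain rfl : σ = σ' := funext fun i => eq_of_heq (hσ i)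
  rw [eq_of_heq ht]

namespace Tree

variable {P : PlainOperad.{u}}

/-- Evaluation of a tree of operations of `P` in `P`: the counit of the free operad adjunction. -/
def eval : ∀ {n : ℕ}, Tree P.Op n → P.Op n
  | _, leaf => P.one
  | _, node φ τ => P.comp φ (fun i => eval (τ i))

theorem eval_heq {n n' : ℕ} (hn : n = n') {t : Tree P.Op n} {t' : Tree P.Op n'} (h : HEq t t') :
    HEq t.eval t'.eval := by
  subst hn; rw [eq_of_heq h]

theorem eval_graft : ∀ {n : ℕ} (t : Tree P.Op n) {k : Fin n → ℕ} (σ : ∀ i, Tree P.Op (k i)),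
    (graft t σ).eval = P.comp t.eval (fun i => (σ i).eval)
  | _, leaf, k, σ => by
    apply eq_of_heq
    have h : HEq (graft leaf σ) (σ 0) := by rw [graft]; exact cast_heq _ _
    refine (eval_heq (Fin.sum_univ_one k) h).trans ?_
    rw [eval]
    refine (P.one_comp _).symm.trans (P.comp_congr rfl HEq.rfl ?_ ?_)
    · intro i; rw [Subsingleton.elim i 0]; rfl
    · intro i; rw [Subsingleton.elim i 0]; rfl
  | _, node φ τ, k, σ => by
    apply eq_of_heq
    rw [graft]
    refine (eval_heq (sum_idx k) (cast_heq _ _)).trans ?_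
    rw [eval, eval]
    refine HEq.trans ?_ (P.assoc _ _ _)
    refine P.comp_congr rfl HEq.rfl (fun _ => rfl) fun i => ?_
    exact heq_of_eq (eval_graft (τ i) _)

theorem eval_corolla {n : ℕ} (p : P.Op n) : (corolla p).eval = p := by
  apply eq_of_heq
  refine (eval_heq (by simp) (cast_heq _ _)).trans ?_
  rw [eval]
  exact P.comp_one p

end Tree

/-- The free plain operad on a signature: trees, with grafting. -/
def freeOperad (Φ : ℕ → Type u) : PlainOperad.{u} where
  Op := Tree Φ
  one := Tree.leaf
  comp t σ := Tree.graft t σ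
  one_comp := Tree.leaf_graft
  comp_one := Tree.graft_leaf
  assoc p q r := Tree.graft_assoc p q r

/-- A plain operad enriched in categories: each `comp` is a functor in all its arguments
(with arrow part `compMap`), and the operad axioms hold strictly on objects and on arrows. -/
structure CatOperad where
  Cell : ℕ → Type w
  [cat : ∀ n, Category.{w'} (Cell n)]
  one : Cell 1
  comp : ∀ {n : ℕ} {k : Fin n → ℕ}, Cell n → (∀ i, Cell (k i)) → Cell (∑ i, k i)
  compMap : ∀ {n : ℕ} {k : Fin n → ℕ} {q q' : Cell n} {r r' : ∀ i, Cell (k i)},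
    (q ⟶ q') → (∀ i, r i ⟶ r' i) → (comp q r ⟶ comp q' r')
  compMap_id : ∀ {n : ℕ} {k : Fin n → ℕ} (q : Cell n) (r : ∀ i, Cell (k i)),
    compMap (𝟙 q) (fun i => 𝟙 (r i)) = 𝟙 (comp q r)
  compMap_comp : ∀ {n : ℕ} {k : Fin n → ℕ} {q q' q'' : Cell n} {r r' r'' : ∀ i, Cell (k i)}
    (f : q ⟶ q') (f' : q' ⟶ q'') (g : ∀ i, r i ⟶ r' i) (g' : ∀ i, r' i ⟶ r'' i),
    compMap (f ≫ f') (fun i => g i ≫ g' i) = compMap f g ≫ compMap f' g'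
  one_comp : ∀ {n : ℕ} (q : Cell n), HEq (comp (k := fun _ : Fin 1 => n) one (fun _ => q)) q
  one_compMap : ∀ {n : ℕ} {q q' : Cell n} (f : q ⟶ q'),
    HEq (compMap (k := fun _ : Fin 1 => n) (𝟙 one) (fun _ => f)) f
  comp_one : ∀ {n : ℕ} (q : Cell n), HEq (comp (k := fun _ : Fin n => 1) q (fun _ => one)) q
  compMap_one : ∀ {n : ℕ} {q q' : Cell n} (f : q ⟶ q'),
    HEq (compMap (k := fun _ : Fin n => 1) f (fun _ => 𝟙 one)) f
  assoc : ∀ {n : ℕ} {k : Fin n → ℕ} {l : Fin (∑ i, k i) → ℕ}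
    (p : Cell n) (q : ∀ i, Cell (k i)) (r : ∀ m, Cell (l m)),
    HEq (comp (k := fun i => ∑ j, l (idx i j)) p
          (fun i => comp (k := fun j => l (idx i j)) (q i) (fun j => r (idx i j))))
        (comp (comp p q) r)
  assocMap : ∀ {n : ℕ} {k : Fin n → ℕ} {l : Fin (∑ i, k i) → ℕ}
    {p p' : Cell n} {q q' : ∀ i, Cell (k i)} {r r' : ∀ m, Cell (l m)}
    (f : p ⟶ p') (g : ∀ i, q i ⟶ q' i) (h : ∀ m, r m ⟶ r' m),
    HEq (compMap (k := fun i => ∑ j, l (idx i j)) f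
          (fun i => compMap (k := fun j => l (idx i j)) (g i) (fun j => h (idx i j))))
        (compMap (compMap f g) h)

attribute [instance] CatOperad.cat

/-- A morphism of `Cat`-operads. -/
structure CatOperad.Hom (Q : CatOperad.{w, w'}) (R : CatOperad.{w₁, w₁'}) where
  level : ∀ n, Q.Cell n ⥤ R.Cell n
  map_one : (level 1).obj Q.one = R.one
  map_comp : ∀ {n : ℕ} {k : Fin n → ℕ} (q : Q.Cell n) (r : ∀ i, Q.Cell (k i)),
    (level _).obj (Q.comp q r) = R.comp ((level n).obj q) (fun i => (level (k i)).obj (r i))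
  map_compMap : ∀ {n : ℕ} {k : Fin n → ℕ} {q q' : Q.Cell n} {r r' : ∀ i, Q.Cell (k i)}
    (f : q ⟶ q') (g : ∀ i, r i ⟶ r' i),
    HEq ((level _).map (Q.compMap f g))
      (R.compMap ((level n).map f) (fun i => (level (k i)).map (g i)))

theorem plift_heq {β : ℕ → Type w} {γ : ∀ n, β n → β n → Prop} {n n' : ℕ} (hn : n = n')
    {x y : β n} {x' y' : β n'} (hx : HEq x x') (hy : HEq y y') (f : PLift (γ n x y))
    (g : PLift (γ n' x' y')) : HEq f g := by
  subst hn
  obtain rfl := eq_of_heq hx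
  obtain rfl := eq_of_heq hy
  exact heq_of_eq (Subsingleton.elim _ _)

theorem sum_one (n : ℕ) : ∑ _i : Fin n, 1 = n := by simp

theorem sum_fin_one (n : ℕ) : ∑ _i : Fin 1, n = n := by simp

/-- The unbiased weakening of `P`: its 1-cells are the operations of the free operad on the
operations of `P`, and there is exactly one 2-cell between two of them if they evaluate to the
same operation of `P`, and none otherwise. -/
def Wk (P : PlainOperad.{u}) : CatOperad.{u, 0} where
  Cell := (freeOperad P.Op).Op
  cat n :=
    { Hom := fun s t : Tree P.Op n => PLift (s.eval = t.eval)
      id := fun _ => ⟨rfl⟩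
      comp := fun f g => ⟨f.down.trans g.down⟩ }
  one := (freeOperad P.Op).one
  comp := (freeOperad P.Op).comp
  compMap {n k q q' r r'} f g := ⟨by
    have hf : Tree.eval q = Tree.eval q' := f.down
    have hg : ∀ i, Tree.eval (r i) = Tree.eval (r' i) := fun i => (g i).down
    exact (Tree.eval_graft q r).trans (by rw [hf, funext hg]; exact (Tree.eval_graft q' r').symm)⟩
  compMap_id _ _ := rfl
  compMap_comp _ _ _ _ := rfl
  one_comp := (freeOperad P.Op).one_comp
  one_compMap _ := plift_heq (γ := fun n (s t : Tree P.Op n) => s.eval = t.eval) (sum_fin_one _)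
    ((freeOperad P.Op).one_comp _) ((freeOperad P.Op).one_comp _) _ _
  comp_one := (freeOperad P.Op).comp_one
  compMap_one _ := plift_heq (γ := fun n (s t : Tree P.Op n) => s.eval = t.eval) (sum_one _)
    ((freeOperad P.Op).comp_one _) ((freeOperad P.Op).comp_one _) _ _
  assoc := (freeOperad P.Op).assoc
  assocMap {n k l} _ _ _ _ _ _ _ _ _ :=
    plift_heq (γ := fun n (s t : Tree P.Op n) => s.eval = t.eval) (sum_idx l).symm
    ((freeOperad P.Op).assoc _ _ _) ((freeOperad P.Op).assoc _ _ _) _ _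

theorem discrete_mk_heq {β : ℕ → Type w} {n n' : ℕ} (hn : n = n') {x : β n} {x' : β n'}
    (h : HEq x x') : HEq (Discrete.mk x) (Discrete.mk x') := by
  subst hn
  rw [eq_of_heq h]

theorem discrete_hom_heq {β : ℕ → Type w} {n n' : ℕ} (hn : n = n')
    {x y : Discrete (β n)} {x' y' : Discrete (β n')} (hx : HEq x x') (hy : HEq y y')
    (f : x ⟶ y) (g : x' ⟶ y') : HEq f g := by
  subst hn
  obtain rfl := eq_of_heq hx
  obtain rfl := eq_of_heq hy
  exact heq_of_eq (Subsingleton.elim _ _)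

/-- The `Cat`-operad `D_* P` whose categories are the discrete categories on the sets of
operations of `P`. -/
def Disc (P : PlainOperad.{u}) : CatOperad.{u, u} where
  Cell n := Discrete (P.Op n)
  one := ⟨P.one⟩
  comp p q := ⟨P.comp p.as (fun i => (q i).as)⟩
  compMap {n k q q' r r'} f g := Discrete.eqToHom (by
    have hg : ∀ i, (r i).as = (r' i).as := fun i => Discrete.eq_of_hom (g i)
    dsimp only
    rw [Discrete.eq_of_hom f, funext hg])
  compMap_id _ _ := Subsingleton.elim _ _
  compMap_comp _ _ _ _ := Subsingleton.elim _ _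
  one_comp _ := discrete_mk_heq (sum_fin_one _) (P.one_comp _)
  one_compMap _ := discrete_hom_heq (sum_fin_one _) (discrete_mk_heq (sum_fin_one _) (P.one_comp _))
    (discrete_mk_heq (sum_fin_one _) (P.one_comp _)) _ _
  comp_one _ := discrete_mk_heq (sum_one _) (P.comp_one _)
  compMap_one _ := discrete_hom_heq (sum_one _) (discrete_mk_heq (sum_one _) (P.comp_one _))
    (discrete_mk_heq (sum_one _) (P.comp_one _)) _ _
  assoc {n k l} p q r := discrete_mk_heq (sum_idx l).symm
    (P.assoc p.as (fun i => (q i).as) (fun m => (r m).as))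
  assocMap {n k l} p p' q q' r r' _ _ _ := discrete_hom_heq (sum_idx l).symm
    (discrete_mk_heq (sum_idx l).symm (P.assoc p.as (fun i => (q i).as) (fun m => (r m).as)))
    (discrete_mk_heq (sum_idx l).symm (P.assoc p'.as (fun i => (q' i).as) (fun m => (r' m).as)))
    _ _

/-- The morphism `Wk P ⟶ D_* P` given on 1-cells by evaluation of trees. -/
def evalHom (P : PlainOperad.{u}) : CatOperad.Hom (Wk P) (Disc P) where
  level n :=
    { obj := fun t => Discrete.mk (Tree.eval t)
      map := fun f => Discrete.eqToHom (PLift.down f)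
      map_id := fun _ => rfl
      map_comp := fun _ _ => (eqToHom_trans _ _).symm }
  map_one := rfl
  map_comp q r := congrArg Discrete.mk (Tree.eval_graft (P := P) q r)
  map_compMap {n k q q' r r'} _ _ := discrete_hom_heq rfl
    (heq_of_eq (congrArg Discrete.mk (Tree.eval_graft (P := P) q r)))
    (heq_of_eq (congrArg Discrete.mk (Tree.eval_graft (P := P) q' r'))) _ _

/-- A (small) algebra in `Cat` for a `Cat`-operad `Q`: a category `A` with functors
`Q_n × Aⁿ ⥤ A`, given by `act` on objects and `actMap` on arrows, compatible strictly with the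
unit and the composition of `Q`. -/
structure Alg (Q : CatOperad.{w, w'}) where
  carrier : Type u
  [cat : Category.{v} carrier]
  act : ∀ {n : ℕ}, Q.Cell n → (Fin n → carrier) → carrier
  actMap : ∀ {n : ℕ} {q q' : Q.Cell n} {a a' : Fin n → carrier},
    (q ⟶ q') → (∀ i, a i ⟶ a' i) → (act q a ⟶ act q' a')
  actMap_id : ∀ {n : ℕ} (q : Q.Cell n) (a : Fin n → carrier),
    actMap (𝟙 q) (fun i => 𝟙 (a i)) = 𝟙 (act q a)
  actMap_comp : ∀ {n : ℕ} {q q' q'' : Q.Cell n} {a a' a'' : Fin n → carrier}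
    (f : q ⟶ q') (f' : q' ⟶ q'') (g : ∀ i, a i ⟶ a' i) (g' : ∀ i, a' i ⟶ a'' i),
    actMap (f ≫ f') (fun i => g i ≫ g' i) = actMap f g ≫ actMap f' g'
  one_act : ∀ a : Fin 1 → carrier, act Q.one a = a 0
  one_actMap : ∀ {a a' : Fin 1 → carrier} (g : ∀ i, a i ⟶ a' i),
    HEq (actMap (𝟙 Q.one) g) (g 0)
  comp_act : ∀ {n : ℕ} {k : Fin n → ℕ} (q : Q.Cell n) (r : ∀ i, Q.Cell (k i))
    (a : Fin (∑ i, k i) → carrier),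
    act (Q.comp q r) a = act q (fun i => act (r i) (fun j => a (idx i j)))
  comp_actMap : ∀ {n : ℕ} {k : Fin n → ℕ} {q q' : Q.Cell n} {r r' : ∀ i, Q.Cell (k i)}
    {a a' : Fin (∑ i, k i) → carrier}
    (f : q ⟶ q') (g : ∀ i, r i ⟶ r' i) (h : ∀ m, a m ⟶ a' m),
    HEq (actMap (Q.compMap f g) h)
      (actMap f (fun i => actMap (g i) (fun j => h (idx i j))))

attribute [instance] Alg.cat

/-- Restriction of algebras along a morphism of `Cat`-operads. -/
def Alg.restrict {Q : CatOperad.{w, w'}} {R : CatOperad.{w₁, w₁'}} (F : CatOperad.Hom Q R)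
    (A : Alg.{v, u} R) : Alg.{v, u} Q where
  carrier := A.carrier
  act q a := A.act ((F.level _).obj q) a
  actMap f g := A.actMap ((F.level _).map f) g
  actMap_id q a := by rw [CategoryTheory.Functor.map_id, A.actMap_id]
  actMap_comp f f' g g' := by rw [Functor.map_comp, A.actMap_comp]
  one_act a := by rw [F.map_one, A.one_act]
  one_actMap {a a'} g := by
    refine HEq.trans ?_ (A.one_actMap g)
    rw [CategoryTheory.Functor.map_id, F.map_one]
  comp_act q r a := by rw [F.map_comp, A.comp_act]
  comp_actMap {n k q q' r r' a a'} f g h := by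
    refine HEq.trans ?_ (A.comp_actMap _ _ h)
    have key : ∀ {s s' : R.Cell (∑ i, k i)} {t t' : R.Cell (∑ i, k i)} (x : s ⟶ s') (y : t ⟶ t'),
        s = t → s' = t' → HEq x y → HEq (A.actMap x h) (A.actMap y h) := by
      intro s s' t t' x y hs hs' hxy
      subst hs hs'
      rw [eq_of_heq hxy]
    exact key _ _ (F.map_comp _ _) (F.map_comp _ _) (F.map_compMap f g)

variable {Q : CatOperad.{w, w'}}

/-- A weak map of `Q`-algebras: a functor together with invertible coherence maps
`q(F a₁, …, F aₙ) ⟶ F (q(a₁, …, aₙ))`, natural in `q` and in the `aᵢ`, and compatible with the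
unit and the composition of `Q`. -/
@[ext]
structure WeakHom (A B : Alg.{v, u} Q) where
  functor : A.carrier ⥤ B.carrier
  coh : ∀ {n : ℕ} (q : Q.Cell n) (a : Fin n → A.carrier),
    B.act q (fun i => functor.obj (a i)) ≅ functor.obj (A.act q a)
  coh_natural : ∀ {n : ℕ} {q q' : Q.Cell n} {a a' : Fin n → A.carrier}
    (f : q ⟶ q') (g : ∀ i, a i ⟶ a' i),
    B.actMap f (fun i => functor.map (g i)) ≫ (coh q' a').hom =
      (coh q a).hom ≫ functor.map (A.actMap f g)
  coh_one : ∀ a : Fin 1 → A.carrier,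
    (coh Q.one a).hom =
      eqToHom ((B.one_act _).trans (congrArg functor.obj (A.one_act a).symm))
  coh_comp : ∀ {n : ℕ} {k : Fin n → ℕ} (q : Q.Cell n) (r : ∀ i, Q.Cell (k i))
    (a : Fin (∑ i, k i) → A.carrier),
    (coh (Q.comp q r) a).hom =
      eqToHom (B.comp_act q r _) ≫
        B.actMap (𝟙 q) (fun i => (coh (r i) (fun j => a (idx i j))).hom) ≫
        (coh q (fun i => A.act (r i) (fun j => a (idx i j)))).hom ≫
        eqToHom (congrArg functor.obj (A.comp_act q r a).symm)

/-- A weak map is strict if all of its coherence maps are identities. -/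
def WeakHom.IsStrict {A B : Alg.{v, u} Q} (F : WeakHom A B) : Prop :=
  ∀ {n : ℕ} (q : Q.Cell n) (a : Fin n → A.carrier),
    ∃ h : B.act q (fun i => F.functor.obj (a i)) = F.functor.obj (A.act q a),
      (F.coh q a).hom = eqToHom h

/-- A transformation between weak maps of `Q`-algebras. -/
@[ext]
structure Trans {A B : Alg.{v, u} Q} (F G : WeakHom A B) where
  nat : F.functor ⟶ G.functor
  comm : ∀ {n : ℕ} (q : Q.Cell n) (a : Fin n → A.carrier),
    (F.coh q a).hom ≫ nat.app (A.act q a) =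
      B.actMap (𝟙 q) (fun i => nat.app (a i)) ≫ (G.coh q a).hom

theorem Alg.actMap_comp_id {A : Alg.{v, u} Q} {n : ℕ} {q : Q.Cell n} {a a' a'' : Fin n → A.carrier}
    (g : ∀ i, a i ⟶ a' i) (g' : ∀ i, a' i ⟶ a'' i) :
    A.actMap (𝟙 q) (fun i => g i ≫ g' i) = A.actMap (𝟙 q) g ≫ A.actMap (𝟙 q) g' := by
  rw [← A.actMap_comp, Category.id_comp]

theorem Alg.actMap_eqToHom {A : Alg.{v, u} Q} {n : ℕ} (q : Q.Cell n) {a a' : Fin n → A.carrier}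
    (h : ∀ i, a i = a' i) :
    A.actMap (𝟙 q) (fun i => eqToHom (h i)) = eqToHom (by rw [funext h]) := by
  obtain rfl : a = a' := funext h
  exact A.actMap_id q a

/-- The identity weak map. -/
def WeakHom.id (A : Alg.{v, u} Q) : WeakHom A A where
  functor := 𝟭 _
  coh _ _ := Iso.refl _
  coh_natural f g := by simp
  coh_one a := by simp
  coh_comp q r a := by simp [A.actMap_id]

/-- Composition of weak maps. -/
def WeakHom.comp {A B C : Alg.{v, u} Q} (F : WeakHom A B) (G : WeakHom B C) : WeakHom A C where
  functor := F.functor ⋙ G.functor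
  coh q a := G.coh q _ ≪≫ G.functor.mapIso (F.coh q a)
  coh_natural f g := by
    have h1 := G.coh_natural f (fun i => F.functor.map (g i))
    have h2 := congrArg G.functor.map (F.coh_natural f g)
    simp only [Functor.map_comp] at h2
    simp only [Functor.comp_map, Functor.comp_obj, Iso.trans_hom, Functor.mapIso_hom,
      Category.assoc]
    rw [reassoc_of% h1, h2]
  coh_one a := by
    simp [G.coh_one, F.coh_one, eqToHom_map]
  coh_comp q r a := by
    have h1 := G.coh_natural (𝟙 q) (fun i => (F.coh (r i) (fun j => a (idx i j))).hom)
    simp only [Functor.comp_obj, Iso.trans_hom, Functor.mapIso_hom, G.coh_comp, F.coh_comp,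
      Functor.map_comp, Category.assoc, eqToHom_map, eqToHom_trans_assoc, eqToHom_refl,
      Category.id_comp, Alg.actMap_comp_id]
    rw [reassoc_of% h1]

instance : CategoryStruct (Alg.{v, u} Q) where
  Hom A B := WeakHom A B
  id A := WeakHom.id A
  comp F G := WeakHom.comp F G

instance Alg.homCategory (A B : Alg.{v, u} Q) : Category (A ⟶ B) where
  Hom F G := Trans F G
  id F := { nat := 𝟙 _, comm := fun q a => by simp [B.actMap_id] }
  comp σ τ :=
    { nat := σ.nat ≫ τ.nat
      comm := fun q a => by
        simp only [NatTrans.comp_app, Alg.actMap_comp_id, Category.assoc]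
        rw [reassoc_of% (σ.comm q a), τ.comm] }
  id_comp σ := Trans.ext (Category.id_comp _)
  comp_id σ := Trans.ext (Category.comp_id _)
  assoc σ τ ρ := Trans.ext (Category.assoc _ _ _)

theorem WeakHom.ext_of_hom {A B : Alg.{v, u} Q} {F G : A ⟶ B} (h : F.functor = G.functor)
    (h' : ∀ {n : ℕ} (q : Q.Cell n) (a : Fin n → A.carrier), HEq (F.coh q a).hom (G.coh q a).hom) :
    F = G := by
  obtain ⟨F, φ, _, _, _⟩ := F
  obtain ⟨G, ψ, _, _, _⟩ := G
  obtain rfl : F = G := h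
  have : @φ = @ψ := by
    funext n q a
    exact Iso.ext (eq_of_heq (h' q a))
  subst this
  rfl

theorem Alg.id_comp' {A B : Alg.{v, u} Q} (F : A ⟶ B) : 𝟙 A ≫ F = F :=
  WeakHom.ext_of_hom rfl fun q a => heq_of_eq
    ((congrArg _ (F.functor.map_id _)).trans (Category.comp_id (F.coh q a).hom))

theorem Alg.comp_id' {A B : Alg.{v, u} Q} (F : A ⟶ B) : F ≫ 𝟙 B = F :=
  WeakHom.ext_of_hom rfl fun q a => heq_of_eq (Category.id_comp (F.coh q a).hom)

theorem Alg.assoc' {A B C D : Alg.{v, u} Q} (F : A ⟶ B) (G : B ⟶ C) (H : C ⟶ D) :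
    (F ≫ G) ≫ H = F ≫ G ≫ H :=
  WeakHom.ext_of_hom rfl fun q a => heq_of_eq (by
    show (H.coh q _).hom ≫ H.functor.map ((G.coh q _).hom ≫ G.functor.map (F.coh q a).hom) =
      ((H.coh q _).hom ≫ H.functor.map (G.coh q _).hom) ≫
        H.functor.map (G.functor.map (F.coh q a).hom)
    rw [Functor.map_comp, Category.assoc])

theorem Trans.eqToHom_nat {A B : Alg.{v, u} Q} {F G : A ⟶ B} (h : F = G) :
    (eqToHom h : F ⟶ G).nat = eqToHom (congrArg WeakHom.functor h) := by
  subst h; rfl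

@[ext]
theorem Trans.hom_ext {A B : Alg.{v, u} Q} {F G : A ⟶ B} {σ τ : F ⟶ G}
    (h : ∀ a, σ.nat.app a = τ.nat.app a) : σ = τ :=
  Trans.ext (NatTrans.ext (funext h))

@[simp]
theorem Trans.comp_app {A B : Alg.{v, u} Q} {F G H : A ⟶ B} (σ : F ⟶ G) (τ : G ⟶ H)
    (a : A.carrier) : (σ ≫ τ).nat.app a = σ.nat.app a ≫ τ.nat.app a := rfl

@[simp]
theorem Trans.id_app {A B : Alg.{v, u} Q} (F : A ⟶ B) (a : A.carrier) :
    (𝟙 F : F ⟶ F).nat.app a = 𝟙 _ := rfl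

theorem Trans.eqToHom_app {A B : Alg.{v, u} Q} {F G : A ⟶ B} (h : F = G) (a : A.carrier) :
    (eqToHom h : F ⟶ G).nat.app a = eqToHom (by rw [h]) := by
  subst h; rfl

/-- Left whiskering of a transformation by a weak map. -/
def Trans.whiskerLeft {A B C : Alg.{v, u} Q} (F : A ⟶ B) {G H : B ⟶ C} (σ : G ⟶ H) :
    F ≫ G ⟶ F ≫ H where
  nat := Functor.whiskerLeft F.functor σ.nat
  comm := fun q a => by
    show ((G.coh q _).hom ≫ G.functor.map (F.coh q a).hom) ≫ σ.nat.app _ =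
      C.actMap (𝟙 q) (fun i => σ.nat.app (F.functor.obj (a i))) ≫
        (H.coh q _).hom ≫ H.functor.map (F.coh q a).hom
    rw [Category.assoc, σ.nat.naturality, reassoc_of% (σ.comm q)]

/-- Right whiskering of a transformation by a weak map. -/
def Trans.whiskerRight {A B C : Alg.{v, u} Q} {F G : A ⟶ B} (σ : F ⟶ G) (H : B ⟶ C) :
    F ≫ H ⟶ G ≫ H where
  nat := Functor.whiskerRight σ.nat H.functor
  comm := fun q a => by
    show ((H.coh q _).hom ≫ H.functor.map (F.coh q a).hom) ≫ H.functor.map (σ.nat.app _) =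
      C.actMap (𝟙 q) (fun i => H.functor.map (σ.nat.app (a i))) ≫
        (H.coh q _).hom ≫ H.functor.map (G.coh q a).hom
    rw [Category.assoc, ← H.functor.map_comp, σ.comm, reassoc_of% (H.coh_natural (𝟙 q)),
      H.functor.map_comp]

@[simp]
theorem Trans.whiskerLeft_app {A B C : Alg.{v, u} Q} (F : A ⟶ B) {G H : B ⟶ C} (σ : G ⟶ H)
    (a : A.carrier) : (Trans.whiskerLeft F σ).nat.app a = σ.nat.app (F.functor.obj a) := rfl

@[simp]
theorem Trans.whiskerRight_app {A B C : Alg.{v, u} Q} {F G : A ⟶ B} (σ : F ⟶ G) (H : B ⟶ C)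
    (a : A.carrier) :
    (Trans.whiskerRight σ H).nat.app a = H.functor.map (σ.nat.app a) := rfl

@[simp]
theorem Alg.comp_obj {A B C : Alg.{v, u} Q} (F : A ⟶ B) (G : B ⟶ C) (a : A.carrier) :
    (F ≫ G).functor.obj a = G.functor.obj (F.functor.obj a) := rfl

@[simp]
theorem Alg.comp_map {A B C : Alg.{v, u} Q} (F : A ⟶ B) (G : B ⟶ C) {a b : A.carrier}
    (f : a ⟶ b) : (F ≫ G).functor.map f = G.functor.map (F.functor.map f) := rfl

@[simp]
theorem Alg.id_obj (A : Alg.{v, u} Q) (a : A.carrier) : (𝟙 A : A ⟶ A).functor.obj a = a := rfl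

@[simp]
theorem Alg.id_map (A : Alg.{v, u} Q) {a b : A.carrier} (f : a ⟶ b) :
    (𝟙 A : A ⟶ A).functor.map f = f := rfl

@[simp]
theorem Trans.assoc_hom_app {A B C D : Alg.{v, u} Q} (F : A ⟶ B) (G : B ⟶ C) (H : C ⟶ D)
    (a : A.carrier) : (eqToHom (Alg.assoc' F G H)).nat.app a = 𝟙 _ := Trans.eqToHom_app _ _

@[simp]
theorem Trans.assoc_inv_app {A B C D : Alg.{v, u} Q} (F : A ⟶ B) (G : B ⟶ C) (H : C ⟶ D)
    (a : A.carrier) : (eqToHom (Alg.assoc' F G H).symm).nat.app a = 𝟙 _ := Trans.eqToHom_app _ _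

@[simp]
theorem Trans.id_comp_hom_app {A B : Alg.{v, u} Q} (F : A ⟶ B) (a : A.carrier) :
    (eqToHom (Alg.id_comp' F)).nat.app a = 𝟙 _ := Trans.eqToHom_app _ _

@[simp]
theorem Trans.id_comp_inv_app {A B : Alg.{v, u} Q} (F : A ⟶ B) (a : A.carrier) :
    (eqToHom (Alg.id_comp' F).symm).nat.app a = 𝟙 _ := Trans.eqToHom_app _ _

@[simp]
theorem Trans.comp_id_hom_app {A B : Alg.{v, u} Q} (F : A ⟶ B) (a : A.carrier) :
    (eqToHom (Alg.comp_id' F)).nat.app a = 𝟙 _ := Trans.eqToHom_app _ _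

@[simp]
theorem Trans.comp_id_inv_app {A B : Alg.{v, u} Q} (F : A ⟶ B) (a : A.carrier) :
    (eqToHom (Alg.comp_id' F).symm).nat.app a = 𝟙 _ := Trans.eqToHom_app _ _

/-- The 2-category of `Q`-algebras, weak maps and transformations. -/
instance Alg.bicategory : Bicategory (Alg.{v, u} Q) where
  homCategory A B := Alg.homCategory A B
  whiskerLeft F _ _ σ := Trans.whiskerLeft F σ
  whiskerRight σ H := Trans.whiskerRight σ H
  associator F G H := eqToIso (Alg.assoc' F G H)
  leftUnitor F := eqToIso (Alg.id_comp' F)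
  rightUnitor F := eqToIso (Alg.comp_id' F)
  whiskerLeft_id _ _ := by ext; simp
  whiskerLeft_comp _ _ _ _ _ _ := by ext; simp
  id_whiskerLeft _ := by ext; simp
  comp_whiskerLeft _ _ _ _ _ := by ext; simp
  id_whiskerRight _ _ := by ext; simp
  comp_whiskerRight _ _ _ := by ext; simp
  whiskerRight_id _ := by ext; simp
  whiskerRight_comp _ _ _ := by ext; simp
  whisker_assoc _ _ _ _ _ := by ext; simp
  whisker_exchange _ _ := by ext; simp
  pentagon _ _ _ _ := by ext; simp [Trans.eqToHom_app]; rfl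
  triangle _ _ := by ext; simp

instance : Bicategory.Strict (Alg.{v, u} Q) where
  id_comp := Alg.id_comp'
  comp_id := Alg.comp_id'
  assoc := Alg.assoc'
  leftUnitor_eqToIso _ := rfl
  rightUnitor_eqToIso _ := rfl
  associator_eqToIso _ _ _ := rfl

section Strict

variable (P : PlainOperad.{u})

/-- The 2-category of (small) weak `P`-categories, weak `P`-functors and `P`-transformations. -/
abbrev WkPCat := Alg.{v, u} (Wk P)

/-- A (small) strict `P`-category: an algebra for `D_* P`. -/
structure StrPCat where
  toAlg : Alg.{v, u} (Disc P)

variable {P}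

/-- A strict `P`-category regarded as a weak `P`-category. -/
def StrPCat.toWk (A : StrPCat.{v, u} P) : WkPCat.{v, u} P :=
  A.toAlg.restrict (evalHom P)

/-- A strict `P`-functor: one that preserves the action of `P` on the nose. Since evaluation
`(Wk P)_n ⟶ P_n` is surjective on objects, this may be checked on the 1-cells of `Wk P`. -/
@[ext]
structure StrPCat.Hom (A B : StrPCat.{v, u} P) where
  hom : A.toWk ⟶ B.toWk
  strict : WeakHom.IsStrict hom

theorem WeakHom.isStrict_id (A : Alg.{v, u} Q) : WeakHom.IsStrict (𝟙 A : A ⟶ A) :=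
  fun _ _ => ⟨rfl, rfl⟩

theorem WeakHom.isStrict_comp {A B C : Alg.{v, u} Q} {F : A ⟶ B} {G : B ⟶ C}
    (hF : WeakHom.IsStrict F) (hG : WeakHom.IsStrict G) : WeakHom.IsStrict (F ≫ G) := by
  intro n q a
  obtain ⟨h1, e1⟩ := hF q a
  obtain ⟨h2, e2⟩ := hG q (fun i => F.functor.obj (a i))
  refine ⟨h2.trans (congrArg G.functor.obj h1), ?_⟩
  show (G.coh q _).hom ≫ G.functor.map (F.coh q a).hom = _
  rw [e1, e2, eqToHom_map, eqToHom_trans]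
  rfl

instance : CategoryStruct (StrPCat.{v, u} P) where
  Hom A B := StrPCat.Hom A B
  id A := ⟨𝟙 A.toWk, WeakHom.isStrict_id _⟩
  comp F G := ⟨F.hom ≫ G.hom, WeakHom.isStrict_comp F.strict G.strict⟩

/-- A `P`-transformation between strict `P`-functors. -/
@[ext]
structure StrPCat.Hom₂ {A B : StrPCat.{v, u} P} (F G : A ⟶ B) where
  hom : F.hom ⟶ G.hom

instance StrPCat.homCategory (A B : StrPCat.{v, u} P) : Category (A ⟶ B) where
  Hom F G := StrPCat.Hom₂ F G
  id F := ⟨𝟙 F.hom⟩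
  comp σ τ := ⟨σ.hom ≫ τ.hom⟩

@[ext]
theorem StrPCat.hom₂_ext {A B : StrPCat.{v, u} P} {F G : A ⟶ B} {σ τ : F ⟶ G}
    (h : σ.hom = τ.hom) : σ = τ :=
  StrPCat.Hom₂.ext h

@[simp]
theorem StrPCat.comp_hom₂ {A B : StrPCat.{v, u} P} {F G H : A ⟶ B} (σ : F ⟶ G) (τ : G ⟶ H) :
    (σ ≫ τ).hom = σ.hom ≫ τ.hom := rfl

@[simp]
theorem StrPCat.id_hom₂ {A B : StrPCat.{v, u} P} (F : A ⟶ B) :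
    (𝟙 F : F ⟶ F).hom = 𝟙 F.hom := rfl

@[simp]
theorem StrPCat.comp_hom {A B C : StrPCat.{v, u} P} (F : A ⟶ B) (G : B ⟶ C) :
    (F ≫ G).hom = F.hom ≫ G.hom := rfl

@[simp]
theorem StrPCat.id_hom (A : StrPCat.{v, u} P) : (𝟙 A : A ⟶ A).hom = 𝟙 A.toWk := rfl

theorem StrPCat.eqToHom_hom {A B : StrPCat.{v, u} P} {F G : A ⟶ B} (h : F = G) :
    (eqToHom h : F ⟶ G).hom = eqToHom (congrArg StrPCat.Hom.hom h) := by
  subst h; rfl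

/-- An isomorphism of strict `P`-functors from one of the underlying weak `P`-functors. -/
def StrPCat.isoMk {A B : StrPCat.{v, u} P} {F G : A ⟶ B} (σ : F.hom ≅ G.hom) : F ≅ G where
  hom := ⟨σ.hom⟩
  inv := ⟨σ.inv⟩
  hom_inv_id := StrPCat.hom₂_ext σ.hom_inv_id
  inv_hom_id := StrPCat.hom₂_ext σ.inv_hom_id

open Bicategory in
/-- The 2-category of (small) strict `P`-categories, strict `P`-functors and
`P`-transformations. -/
instance StrPCat.bicategory : Bicategory (StrPCat.{v, u} P) where
  homCategory A B := StrPCat.homCategory A B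
  whiskerLeft F _ _ σ := ⟨F.hom ◁ σ.hom⟩
  whiskerRight σ H := ⟨σ.hom ▷ H.hom⟩
  associator F G H := StrPCat.isoMk (α_ F.hom G.hom H.hom)
  leftUnitor F := StrPCat.isoMk (λ_ F.hom)
  rightUnitor F := StrPCat.isoMk (ρ_ F.hom)
  whiskerLeft_id _ _ := StrPCat.hom₂_ext (Bicategory.whiskerLeft_id _ _)
  whiskerLeft_comp _ _ _ _ _ _ := StrPCat.hom₂_ext (Bicategory.whiskerLeft_comp _ _ _)
  id_whiskerLeft _ := StrPCat.hom₂_ext (Bicategory.id_whiskerLeft _)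
  comp_whiskerLeft _ _ _ _ _ := StrPCat.hom₂_ext (Bicategory.comp_whiskerLeft _ _ _)
  id_whiskerRight _ _ := StrPCat.hom₂_ext (Bicategory.id_whiskerRight _ _)
  comp_whiskerRight _ _ _ := StrPCat.hom₂_ext (Bicategory.comp_whiskerRight _ _ _)
  whiskerRight_id _ := StrPCat.hom₂_ext (Bicategory.whiskerRight_id _)
  whiskerRight_comp _ _ _ := StrPCat.hom₂_ext (Bicategory.whiskerRight_comp _ _ _)
  whisker_assoc _ _ _ _ _ := StrPCat.hom₂_ext (Bicategory.whisker_assoc _ _ _)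
  whisker_exchange _ _ := StrPCat.hom₂_ext (Bicategory.whisker_exchange _ _)
  pentagon _ _ _ _ := StrPCat.hom₂_ext (Bicategory.pentagon _ _ _ _)
  triangle _ _ := StrPCat.hom₂_ext (Bicategory.triangle _ _)

theorem StrPCat.iso_ext {A B : StrPCat.{v, u} P} {F G : A ⟶ B} (h : F = G) {σ : F ≅ G}
    (h' : σ.hom.hom = eqToHom (congrArg StrPCat.Hom.hom h)) : σ = eqToIso h :=
  Iso.ext (StrPCat.hom₂_ext (h'.trans (StrPCat.eqToHom_hom h).symm))

instance : Bicategory.Strict (StrPCat.{v, u} P) where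
  id_comp F := StrPCat.Hom.ext (Bicategory.Strict.id_comp F.hom)
  comp_id F := StrPCat.Hom.ext (Bicategory.Strict.comp_id F.hom)
  assoc F G H := StrPCat.Hom.ext (Bicategory.Strict.assoc F.hom G.hom H.hom)
  leftUnitor_eqToIso _ := StrPCat.iso_ext _ rfl
  rightUnitor_eqToIso _ := StrPCat.iso_ext _ rfl
  associator_eqToIso _ _ _ := StrPCat.iso_ext _ rfl

variable (P)

/-- The inclusion `U'` of the 2-category of strict `P`-categories into the 2-category of weak
`P`-categories, as a strict 2-functor. -/
def inclusion : StrictPseudofunctor (StrPCat.{v, u} P) (WkPCat.{v, u} P) :=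
  StrictPseudofunctor.mk''
    { obj := StrPCat.toWk
      map := fun F => F.hom
      map₂ := fun σ => σ.hom
      map₂_whisker_left := fun F _ _ σ =>
        ((Category.id_comp _).trans (Category.comp_id _)).symm
      map₂_whisker_right := fun σ H =>
        ((Category.id_comp _).trans (Category.comp_id _)).symm }

/-- The forgetful functor `U'` between the underlying 1-categories. -/
abbrev forgetStr : StrPCat.{v, u} P ⥤ WkPCat.{v, u} P :=
  (inclusion P).toFunctor

end Strict

/-- An object of `R ∘ X = ∐ₙ R_n × Xⁿ`. -/
structure Kel (R : PlainOperad.{u}) (X : Type u) where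
  arity : ℕ
  op : R.Op arity
  args : Fin arity → X

namespace Kel

variable {R : PlainOperad.{u}} {X : Type u}

theorem ext' {x y : Kel R X} (h : x.arity = y.arity) (h₁ : HEq x.op y.op)
    (h₂ : ∀ i : Fin x.arity, x.args i = y.args (Fin.cast h i)) : x = y := by
  obtain ⟨n, p, a⟩ := x
  obtain ⟨m, q, b⟩ := y
  dsimp only at h h₁ h₂
  subst h
  obtain rfl := eq_of_heq h₁
  obtain rfl : a = b := funext h₂
  rfl

/-- Concatenation of lists. -/
def flatten {n : ℕ} {k : Fin n → ℕ} (a : ∀ i, Fin (k i) → X) (m : Fin (∑ i, k i)) : X :=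
  a (finSigmaFinEquiv.symm m).1 (finSigmaFinEquiv.symm m).2

@[simp]
theorem flatten_idx {n : ℕ} {k : Fin n → ℕ} (a : ∀ i, Fin (k i) → X) (i : Fin n) (j : Fin (k i)) :
    flatten a (idx i j) = a i j := by
  exact congrArg (fun s : (i : Fin n) × Fin (k i) => a s.1 s.2)
    (finSigmaFinEquiv.symm_apply_apply (⟨i, j⟩ : (i : Fin n) × Fin (k i)))

theorem flatten_eta {n : ℕ} {k : Fin n → ℕ} (c : Fin (∑ i, k i) → X) :
    flatten (fun i j => c (idx i j)) = c := by
  funext m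
  obtain ⟨i, j, rfl⟩ := idx_surj m
  exact flatten_idx _ i j

/-- The free action of an operation: `q · (pᵢ, aᵢ) = (q ∘ (p₁, …, pₙ), a₁ ⋯ aₙ)`. -/
def bind {n : ℕ} (q : R.Op n) (x : Fin n → Kel R X) : Kel R X where
  arity := ∑ i, (x i).arity
  op := R.comp q (fun i => (x i).op)
  args := flatten (fun i => (x i).args)

theorem bind_one (x : Fin 1 → Kel R X) : bind R.one x = x 0 := by
  obtain ⟨y, rfl⟩ : ∃ y, x = fun _ => y := ⟨x 0, by
    funext i; rw [Subsingleton.elim i 0]⟩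
  refine ext' (sum_fin_one _) (R.one_comp _) fun m => ?_
  obtain ⟨i, j, rfl⟩ := idx_surj m
  change flatten (fun _ => y.args) (idx i j) = y.args _
  rw [flatten_idx]
  congr 1
  ext
  have : i = 0 := Subsingleton.elim _ _
  subst this
  exact ((idx_val' (k := fun _ : Fin 1 => y.arity) 0 j).trans (by simp)).symm

theorem bind_assoc {n : ℕ} {k : Fin n → ℕ} (p : R.Op n) (q : ∀ i, R.Op (k i))
    (x : Fin (∑ i, k i) → Kel R X) :
    bind p (fun i => bind (q i) (fun j => x (idx i j))) = bind (R.comp p q) x := by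
  refine ext' (sum_idx (fun m => (x m).arity)).symm
    (R.assoc p q (fun m => (x m).op)) fun m => ?_
  obtain ⟨i, m, rfl⟩ := idx_surj m
  obtain ⟨j, m, rfl⟩ := idx_surj m
  change flatten (fun i => flatten (fun j => (x (idx i j)).args)) (idx i (idx j m)) =
    flatten (fun m => (x m).args) _
  rw [flatten_idx, flatten_idx, ← flatten_idx (fun m => (x m).args) (idx i j) m]
  congr 1
  ext
  exact idx_assoc (l := fun m => (x m).arity) i j m

end Kel

section Strictification

variable {P : PlainOperad.{u}} (A : WkPCat.{v, u} P)

/-- The 1-cell of `Wk P` corresponding to an operation of `P`. -/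
def incl {n : ℕ} (p : P.Op n) : (Wk P).Cell n := Tree.corolla p

/-- The operation of `P` to which a 1-cell of `Wk P` evaluates. -/
def ev {n : ℕ} (q : (Wk P).Cell n) : P.Op n := Tree.eval (P := P) q

theorem ev_incl {n : ℕ} (p : P.Op n) : ev (incl p) = p := Tree.eval_corolla p

theorem ev_one : ev (Wk P).one = P.one := rfl

theorem ev_comp {n : ℕ} {k : Fin n → ℕ} (q : (Wk P).Cell n) (r : ∀ i, (Wk P).Cell (k i)) :
    ev ((Wk P).comp q r) = P.comp (ev q) (fun i => ev (r i)) := Tree.eval_graft (P := P) q r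

/-- The unique 2-cell between two 1-cells of `Wk P` which evaluate to the same operation. -/
def cell {n : ℕ} {q q' : (Wk P).Cell n} (h : ev q = ev q') : q ⟶ q' := PLift.up h

theorem ev_eq {n : ℕ} {q q' : (Wk P).Cell n} (f : q ⟶ q') : ev q = ev q' := PLift.down f

theorem cell_uniq {n : ℕ} {q q' : (Wk P).Cell n} (f g : q ⟶ q') : f = g :=
  Subsingleton.elim (α := PLift (ev q = ev q')) f g

/-- The plain operad of 1-cells of a `Cat`-operad. -/
@[reducible]
def CatOperad.cells (Q : CatOperad.{w, w'}) : PlainOperad.{w} where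
  Op := Q.Cell
  one := Q.one
  comp := Q.comp
  one_comp := Q.one_comp
  comp_one := Q.comp_one
  assoc := Q.assoc

abbrev WKel (P : PlainOperad.{u}) (X : Type u) := Kel (Wk P).cells X

namespace Kel

variable {A}

def val (x : WKel P A.carrier) : A.carrier := A.act (Q := Wk P) x.op x.args

def str {X : Type u} (x : WKel P X) : Kel P X := ⟨x.arity, ev x.op, x.args⟩

def hat {X : Type u} (x : Kel P X) : WKel P X := ⟨x.arity, incl x.op, x.args⟩

theorem str_hat {X : Type u} (x : Kel P X) : str (hat x) = x := by
  simp [str, hat, ev_incl]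

theorem str_bind {X : Type u} {n : ℕ} (q : (Wk P).Cell n) (x : Fin n → WKel P X) :
    str (bind (R := (Wk P).cells) q x) = bind (ev q) (fun i => str (x i)) := by
  refine ext' rfl (heq_of_eq (ev_comp q _)) fun m => rfl

theorem val_bind {n : ℕ} (q : (Wk P).Cell n) (x : Fin n → WKel P A.carrier) :
    val (bind (R := (Wk P).cells) q x) = A.act q (fun i => val (x i)) := by
  refine (A.comp_act q (fun i => (x i).op) _).trans ?_
  refine congrArg (A.act q) (funext fun i => congrArg (A.act (x i).op) (funext fun j => ?_))
  exact flatten_idx (fun i => (x i).args) i j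

theorem val_one (a : A.carrier) :
    val (A := A) ⟨1, (Wk P).one, fun _ => a⟩ = a := A.one_act _

/-- The canonical arrow between the values of two formal expressions
with the same strictification. -/
def can {x y : WKel P A.carrier} (h : str x = str y) : val x ⟶ val y := by
  obtain ⟨n, q, a⟩ := x
  obtain ⟨m, r, b⟩ := y
  obtain rfl : n = m := congrArg Kel.arity h
  have h' := h
  simp only [str, Kel.mk.injEq, heq_eq_eq, true_and] at h'
  obtain rfl : a = b := h'.2
  exact A.actMap (cell h'.1) (fun i => 𝟙 _)

theorem can_refl (x : WKel P A.carrier) (h : str x = str x) : can h = 𝟙 (val x) :=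
  A.actMap_id _ _

theorem can_mk {n : ℕ} {q r : (Wk P).Cell n} {a : Fin n → A.carrier} (h' : ev q = ev r)
    (h : str ⟨n, q, a⟩ = str ⟨n, r, a⟩) :
    can (A := A) h = A.actMap (cell h') (fun i => 𝟙 (a i)) := rfl

theorem can_trans {x y z : WKel P A.carrier} (h : str x = str y) (h' : str y = str z) :
    can h ≫ can h' = can (h.trans h') := by
  obtain ⟨n, q, a⟩ := x
  obtain ⟨m, r, b⟩ := y
  obtain ⟨l, s, c⟩ := z
  obtain rfl : n = m := congrArg Kel.arity h
  obtain rfl : n = l := congrArg Kel.arity h'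
  have e := h
  simp only [str, Kel.mk.injEq, heq_eq_eq, true_and] at e
  obtain ⟨e1, rfl⟩ := e
  have e' := h'
  simp only [str, Kel.mk.injEq, heq_eq_eq, true_and] at e'
  obtain ⟨e2, rfl⟩ := e'
  refine (A.actMap_comp (cell e1) (cell e2) (fun i => 𝟙 (a i)) (fun i => 𝟙 (a i))).symm.trans ?_
  simp only [Category.comp_id]
  rfl

/-- `f` is the canonical arrow between the values of the formal expressions `x` and `y`. -/
def IsCan (x y : WKel P A.carrier) {a b : A.carrier} (f : a ⟶ b) : Prop :=
  ∃ (h : str x = str y) (ha : a = val x) (hb : b = val y),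
    f = eqToHom ha ≫ can h ≫ eqToHom hb.symm

theorem IsCan.uniq {x y : WKel P A.carrier} {a b : A.carrier} {f g : a ⟶ b} (hf : IsCan x y f)
    (hg : IsCan x y g) : f = g := by
  obtain ⟨_, _, _, rfl⟩ := hf
  obtain ⟨_, _, _, rfl⟩ := hg
  rfl

theorem IsCan.trans {x y z : WKel P A.carrier} {a b c : A.carrier} {f : a ⟶ b} {g : b ⟶ c}
    (hf : IsCan x y f) (hg : IsCan y z g) : IsCan x z (f ≫ g) := by
  obtain ⟨h, rfl, rfl, rfl⟩ := hf
  obtain ⟨h', _, rfl, rfl⟩ := hg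
  exact ⟨h.trans h', rfl, rfl, by simp [← can_trans h h']⟩

theorem IsCan.eqToHom {x : WKel P A.carrier} {a b : A.carrier} (ha : a = val x) (h : a = b) :
    IsCan x x (eqToHom h) := by
  subst h
  exact ⟨rfl, ha, ha, by rw [can_refl]; simp⟩

theorem IsCan.eqToHom' {x y : WKel P A.carrier} (hxy : x = y) {a b : A.carrier} (ha : a = val x)
    (h : a = b) : IsCan x y (CategoryTheory.eqToHom h) := by
  subst hxy
  exact IsCan.eqToHom ha h

theorem IsCan.id {x : WKel P A.carrier} {a : A.carrier} (ha : a = val x) : IsCan x x (𝟙 a) :=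
  IsCan.eqToHom ha rfl

theorem IsCan.inv {x y : WKel P A.carrier} {a b : A.carrier} {f : a ⟶ b} {g : b ⟶ a}
    (hf : IsCan x y f) (h : g ≫ f = 𝟙 b) : IsCan y x g := by
  obtain ⟨h', rfl, rfl, rfl⟩ := hf
  refine ⟨h'.symm, rfl, rfl, ?_⟩
  have h2 : can h'.symm ≫ can h' = 𝟙 _ := (can_trans _ _).trans (can_refl _ _)
  have h3 : can h' ≫ can h'.symm = 𝟙 _ := (can_trans _ _).trans (can_refl _ _)
  have h4 := congrArg (· ≫ can h'.symm) h
  simpa [h3] using h4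

theorem IsCan.actMap {n : ℕ} {q q' : (Wk P).Cell n} (f : q ⟶ q') {x y : Fin n → WKel P A.carrier}
    {a b : Fin n → A.carrier} {g : ∀ i, a i ⟶ b i} (hg : ∀ i, IsCan (x i) (y i) (g i)) :
    IsCan (bind (R := (Wk P).cells) q x) (bind (R := (Wk P).cells) q' y) (A.actMap f g) := by
  have key : ∀ i, ∃ (k : ℕ) (t s : (Wk P).Cell k) (c : Fin k → A.carrier)
      (hx : x i = ⟨k, t, c⟩) (hy : y i = ⟨k, s, c⟩) (e : ev t = ev s)
      (ha : a i = A.act t c) (hb : b i = A.act s c),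
      g i = CategoryTheory.eqToHom ha ≫ A.actMap (cell e) (fun j => 𝟙 (c j)) ≫
        CategoryTheory.eqToHom hb.symm := by
    intro i
    obtain ⟨h, ha, hb, e⟩ := hg i
    generalize x i = X at *
    generalize y i = Y at *
    obtain ⟨n, q, a⟩ := X
    obtain ⟨m, r, b⟩ := Y
    obtain rfl : n = m := congrArg Kel.arity h
    have h' := h
    simp only [str, Kel.mk.injEq, heq_eq_eq, true_and] at h'
    obtain ⟨h1, rfl⟩ := h'
    exact ⟨n, q, r, a, rfl, rfl, h1, ha, hb, e⟩
  clear hg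
  choose k t s c hx hy e ha hb hg using key
  obtain ⟨C, rfl⟩ : ∃ C : Fin (∑ i, k i) → A.carrier, c = fun i j => C (idx i j) :=
    ⟨flatten c, by funext i j; simp⟩
  obtain rfl : x = fun i => ⟨k i, t i, fun j => C (idx i j)⟩ := funext hx
  obtain rfl : y = fun i => ⟨k i, s i, fun j => C (idx i j)⟩ := funext hy
  obtain rfl : a = fun i => A.act (t i) (fun j => C (idx i j)) := funext ha
  obtain rfl : b = fun i => A.act (s i) (fun j => C (idx i j)) := funext hb
  obtain rfl : g = fun i => A.actMap (cell (e i)) (fun j => 𝟙 (C (idx i j))) := funext fun i => by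
    simpa using hg i
  have bx : ∀ (q : (Wk P).Cell n) (t : ∀ i, (Wk P).Cell (k i)), bind (R := (Wk P).cells) q
      (fun i => ⟨k i, t i, fun j => C (idx i j)⟩) = ⟨∑ i, k i, (Wk P).comp q t, C⟩ := by
    intro q t
    simp [bind, flatten_eta]
  rw [bx, bx]
  have hs : ev ((Wk P).comp q t) = ev ((Wk P).comp q' s) :=
    ev_eq ((Wk P).compMap f (fun i => cell (e i)))
  refine ⟨congrArg (fun o => (⟨_, o, C⟩ : Kel P A.carrier)) hs, (A.comp_act q t C).symm,
    (A.comp_act q' s C).symm, ?_⟩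
  refine (conj_eqToHom_iff_heq (C := A.carrier) _ _ (A.comp_act q t C).symm
    (A.comp_act q' s C).symm).2 ?_
  exact (A.comp_actMap f (fun i => cell (e i)) (fun m => 𝟙 (C m))).symm

end Kel

/-- The object part of `P ∘ A ⟶ Wk P ∘ A ⟶ A`. -/
def realize (x : Kel P A.carrier) : A.carrier := A.act (incl x.op) x.args

theorem act_realize {n : ℕ} (q : (Wk P).Cell n) (x : Fin n → Kel P A.carrier) :
    A.act q (fun i => realize A (x i)) =
      A.act ((Wk P).comp q (fun i => incl (x i).op)) (Kel.flatten (fun i => (x i).args)) := by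
  refine Eq.trans ?_ (A.comp_act q (fun i => incl (x i).op) _).symm
  refine congrArg (A.act q) (funext fun i => congrArg (A.act (incl (x i).op)) (funext fun j => ?_))
  exact (Kel.flatten_idx (fun i => (x i).args) i j).symm

variable {A}

theorem ev_delta {n : ℕ} {q : (Wk P).Cell n} {p : P.Op n} (h : ev q = p) {k : Fin n → ℕ}
    (r : ∀ i, P.Op (k i)) :
    ev ((Wk P).comp q (fun i => incl (r i))) = ev (incl (P.comp p r)) := by
  rw [ev_comp, ev_incl, h]
  simp only [ev_incl]

theorem actMap_cells {n : ℕ} {q q' q'' : (Wk P).Cell n} (f : q ⟶ q') (f' : q' ⟶ q'')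
    (f'' : q ⟶ q'')
    {a a' a'' : Fin n → A.carrier} (g : ∀ i, a i ⟶ a' i) (g' : ∀ i, a' i ⟶ a'' i) :
    A.actMap f g ≫ A.actMap f' g' = A.actMap f'' (fun i => g i ≫ g' i) := by
  rw [← A.actMap_comp, cell_uniq (f ≫ f') f'']

variable (A) in
/-- The component `δ_{q, q'}` at `a` of the action of the 2-cell from `q` to `q'`. -/
def cellIso {n : ℕ} {q q' : (Wk P).Cell n} (h : ev q = ev q') (a : Fin n → A.carrier) :
    A.act q a ≅ A.act q' a where
  hom := A.actMap (cell h) (fun i => 𝟙 (a i))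
  inv := A.actMap (cell h.symm) (fun i => 𝟙 (a i))
  hom_inv_id := by
    rw [actMap_cells _ _ (𝟙 q)]
    simp only [Category.comp_id]
    exact A.actMap_id _ _
  inv_hom_id := by
    rw [actMap_cells _ _ (𝟙 q')]
    simp only [Category.comp_id]
    exact A.actMap_id _ _

/-- If the 1-cell `q` of `Wk P` evaluates to the operation `p` of `P`, this is the isomorphism
`q(p₁(a₁), …, pₙ(aₙ)) = (q ∘ (p₁, …, pₙ))(a₁ ⋯ aₙ) ≅ (p ∘ (p₁, …, pₙ))(a₁ ⋯ aₙ)`, where the first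
composite is formed in `Wk P` and the second in `P`, given by the 2-cell of `Wk P` between them. -/
def delta {n : ℕ} {q : (Wk P).Cell n} {p : P.Op n} (h : ev q = p) (x : Fin n → Kel P A.carrier) :
    A.act q (fun i => realize A (x i)) ≅ realize A (Kel.bind p x) :=
  eqToIso (act_realize A q x) ≪≫
    cellIso A (ev_delta h (fun i => (x i).op)) (Kel.flatten (fun i => (x i).args))

open Kel in
theorem isCan_cellIso {n : ℕ} {q q' : (Wk P).Cell n} (h : ev q = ev q') (a : Fin n → A.carrier) :
    IsCan (A := A) ⟨n, q, a⟩ ⟨n, q', a⟩ (cellIso A h a).hom :=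
  ⟨congrArg (fun o => (⟨n, o, a⟩ : Kel P A.carrier)) h, rfl, rfl,
    ((Category.id_comp _).trans (Category.comp_id _)).symm⟩

open Kel in
theorem isCan_delta {n : ℕ} {q : (Wk P).Cell n} {p : P.Op n} (h : ev q = p)
    (x : Fin n → Kel P A.carrier) :
    IsCan (bind (R := (Wk P).cells) q (fun i => hat (x i))) (hat (bind p x)) (delta h x).hom :=
  IsCan.trans (y := bind (R := (Wk P).cells) q (fun i => hat (x i)))
    (IsCan.eqToHom (val_bind (A := A) q (fun i => hat (x i))).symm (act_realize A q x))
    (isCan_cellIso (ev_delta h (fun i => (x i).op)) (Kel.flatten (fun i => (x i).args)))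

theorem ev_incl_one : ev (incl P.one) = ev (Wk P).one := ev_incl _

/-- The isomorphism `1_P(a) ≅ a`. -/
def unitIso (a : A.carrier) : A.act (incl P.one) (fun _ => a) ≅ a :=
  cellIso A ev_incl_one (fun _ => a) ≪≫ eqToIso (A.one_act (fun _ => a))

theorem cellIso_natural {n : ℕ} {q q' r r' : (Wk P).Cell n} (h : ev q = ev q') (h' : ev r = ev r')
    {a b : Fin n → A.carrier} (f : q ⟶ r) (f' : q' ⟶ r') (g : ∀ i, a i ⟶ b i) :
    A.actMap f g ≫ (cellIso A h' b).hom = (cellIso A h a).hom ≫ A.actMap f' g := by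
  have e : ev q = ev r' := (ev_eq f).trans h'
  simp only [cellIso]
  rw [actMap_cells _ _ (cell e), actMap_cells _ _ (cell e)]
  simp only [Category.id_comp, Category.comp_id]

theorem one_actMap' {a b : Fin 1 → A.carrier} (g : ∀ i, a i ⟶ b i) (f : (Wk P).one ⟶ (Wk P).one) :
    A.actMap f g = eqToHom (A.one_act a) ≫ g 0 ≫ eqToHom (A.one_act b).symm := by
  rw [cell_uniq f (𝟙 _)]
  exact (conj_eqToHom_iff_heq _ _ (A.one_act a) (A.one_act b)).2 (A.one_actMap g)

theorem unitIso_natural {a b : A.carrier} (f : a ⟶ b) (h : incl P.one ⟶ incl P.one) :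
    A.actMap h (fun _ => f) ≫ (unitIso b).hom = (unitIso a).hom ≫ f := by
  simp only [unitIso, Iso.trans_hom, eqToIso.hom, Category.assoc]
  rw [reassoc_of% (cellIso_natural (A := A) ev_incl_one ev_incl_one h (𝟙 _) (fun _ => f)),
    one_actMap']
  simp

open Kel in
theorem isCan_unitIso {a : A.carrier} {y : WKel P A.carrier} (ha : a = val y) :
    IsCan (bind (R := (Wk P).cells) (incl P.one) (fun _ => y)) y (unitIso a).hom := by
  refine IsCan.trans (y := bind (R := (Wk P).cells) (Wk P).one (fun _ => y))
    (IsCan.actMap (cell ev_incl_one) (fun _ => IsCan.id ha)) ?_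
  have e : bind (R := (Wk P).cells) (Wk P).one (fun _ => y) = y :=
    bind_one (R := (Wk P).cells) (fun _ => y)
  rw [e]
  exact IsCan.eqToHom ((A.one_act (fun _ => a)).trans ha) (A.one_act (fun _ => a))

open Kel in
theorem cellIso_delta {n : ℕ} {q q' : (Wk P).Cell n} {p : P.Op n} (h : ev q = ev q')
    (h' : ev q' = p) (x : Fin n → Kel P A.carrier) :
    (cellIso A h (fun i => realize A (x i))).hom ≫ (delta h' x).hom = (delta (h.trans h') x).hom :=
  IsCan.uniq
    (IsCan.trans (IsCan.actMap (cell h) (fun i => IsCan.id (x := hat (x i)) rfl)) (isCan_delta h' x))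
    (isCan_delta _ x)

variable (A)

/-- The underlying category of the strictification of `A`: the middle term of the
bijective-on-objects / full-and-faithful factorization of `P ∘ A ⟶ Wk P ∘ A ⟶ A`. -/
abbrev StCarrier := InducedCategory A.carrier (realize A)

variable {A}

theorem realizeHom_heq {x x' y y' : StCarrier A} (f : x ⟶ y) (g : x' ⟶ y') (hx : x = x')
    (hy : y = y') (h : f.hom = eqToHom (by rw [hx]) ≫ g.hom ≫ eqToHom (by rw [hy])) : HEq f g := by
  subst hx hy
  exact heq_of_eq (InducedCategory.hom_ext (by simpa using h))

open Kel in
theorem delta_one (x : Fin 1 → Kel P A.carrier) (h : realize A (x 0) = realize A (bind P.one x)) :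
    (delta (ev_incl P.one) x).hom =
      eqToHom (congrArg (A.act (incl P.one)) (funext fun i => by rw [Subsingleton.elim i 0])) ≫
      (unitIso (realize A (x 0))).hom ≫ eqToHom h := by
  obtain ⟨y, rfl⟩ : ∃ y, x = fun _ => y := ⟨x 0, by funext i; rw [Subsingleton.elim i 0]⟩
  refine IsCan.uniq (isCan_delta _ _) ?_
  refine IsCan.trans (IsCan.eqToHom (val_bind (A := A) (incl P.one) (fun _ => hat y)).symm _) ?_
  refine IsCan.trans (isCan_unitIso (y := hat y) rfl) ?_
  exact IsCan.eqToHom' (congrArg hat (bind_one (fun _ => y)).symm) rfl _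

theorem stAlg_one {x x' : Fin 1 → StCarrier A} (g : ∀ i, x i ⟶ x' i)
    (f : incl P.one ⟶ incl P.one) (h : Kel.bind P.one x = x 0) (h' : Kel.bind P.one x' = x' 0) :
    (delta (ev_incl P.one) x).inv ≫ A.actMap f (fun i => (g i).hom) ≫
        (delta (ev_incl P.one) x').hom =
      eqToHom (congrArg (realize A) h) ≫ (g 0).hom ≫ eqToHom (congrArg (realize A) h').symm := by
  rw [Iso.inv_comp_eq]
  obtain ⟨y, rfl⟩ : ∃ y, x = fun _ => y := ⟨x 0, by funext i; rw [Subsingleton.elim i 0]⟩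
  obtain ⟨y', rfl⟩ : ∃ y, x' = fun _ => y := ⟨x' 0, by funext i; rw [Subsingleton.elim i 0]⟩
  obtain ⟨g, rfl⟩ : ∃ g' : y ⟶ y', g = fun _ => g' :=
    ⟨g 0, by funext i; rw [Subsingleton.elim i 0]⟩
  rw [delta_one _ (congrArg (realize A) h').symm, delta_one _ (congrArg (realize A) h).symm]
  have := unitIso_natural (A := A) g.hom f
  simp only [eqToHom_refl, Category.id_comp, Category.assoc, eqToHom_trans_assoc]
  rw [reassoc_of% this]

open Kel in
theorem delta_comp {n : ℕ} {k : Fin n → ℕ} (p : P.Op n) (q : ∀ i, P.Op (k i))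
    (x : Fin (∑ i, k i) → Kel P A.carrier)
    (e : ev (incl (P.comp p q)) = ev ((Wk P).comp (incl p) (fun i => incl (q i)))) :
    (cellIso A e (fun m => realize A (x m))).hom ≫
        eqToHom (A.comp_act (incl p) (fun i => incl (q i)) (fun m => realize A (x m))) ≫
        A.actMap (𝟙 (incl p)) (fun i => (delta (ev_incl (q i)) (fun j => x (idx i j))).hom) ≫
        (delta (ev_incl p) (fun i => bind (q i) (fun j => x (idx i j)))).hom =
      (delta (ev_incl (P.comp p q)) x).hom ≫
        eqToHom (congrArg (realize A) (bind_assoc p q x).symm) := by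
  refine IsCan.uniq (x := bind (R := (Wk P).cells) (incl (P.comp p q)) (fun m => hat (x m)))
    (y := hat (bind (P.comp p q) x)) ?_ ?_
  · refine IsCan.trans (IsCan.actMap (cell e) (fun i => IsCan.id (x := hat (x i)) rfl)) ?_
    refine IsCan.trans (IsCan.eqToHom (val_bind (A := A) _ _).symm _) ?_
    rw [← bind_assoc, ← bind_assoc p q x]
    exact IsCan.trans (IsCan.actMap _ (fun i => isCan_delta _ _)) (isCan_delta _ _)
  · exact IsCan.trans (isCan_delta _ _) (IsCan.eqToHom rfl _)

theorem stAlg_comp {n : ℕ} {k : Fin n → ℕ} (p p' : P.Op n) (q q' : ∀ i, P.Op (k i))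
    (F : incl (P.comp p q) ⟶ incl (P.comp p' q')) (f : incl p ⟶ incl p')
    (g : ∀ i, incl (q i) ⟶ incl (q' i)) (x x' : Fin (∑ i, k i) → Kel P A.carrier)
    (h : ∀ m, realize A (x m) ⟶ realize A (x' m)) :
    (delta (ev_incl (P.comp p q)) x).inv ≫ A.actMap F h ≫
        (delta (ev_incl (P.comp p' q')) x').hom =
      eqToHom (congrArg (realize A) (Kel.bind_assoc p q x).symm) ≫
        ((delta (ev_incl p) (fun i => Kel.bind (q i) (fun j => x (idx i j)))).inv ≫
          A.actMap f (fun i => (delta (ev_incl (q i)) (fun j => x (idx i j))).inv ≫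
            A.actMap (g i) (fun j => h (idx i j)) ≫
            (delta (ev_incl (q' i)) (fun j => x' (idx i j))).hom) ≫
          (delta (ev_incl p') (fun i => Kel.bind (q' i) (fun j => x' (idx i j)))).hom) ≫
        eqToHom (congrArg (realize A) (Kel.bind_assoc p' q' x')) := by
  have e : ∀ (p : P.Op n) (q : ∀ i, P.Op (k i)),
      ev (incl (P.comp p q)) = ev ((Wk P).comp (incl p) (fun i => incl (q i))) := fun p q => by
    rw [ev_comp]; simp only [ev_incl]
  have h1 := delta_comp p q x (e p q)
  have h2 := delta_comp p' q' x' (e p' q')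
  have h1' : (delta (ev_incl (P.comp p q)) x).hom ≫
      eqToHom (congrArg (realize A) (Kel.bind_assoc p q x).symm) ≫
      (delta (ev_incl p) (fun i => Kel.bind (q i) (fun j => x (idx i j)))).inv =
      (cellIso A (e p q) (fun m => realize A (x m))).hom ≫
        eqToHom (A.comp_act (incl p) (fun i => incl (q i)) (fun m => realize A (x m))) ≫
        A.actMap (𝟙 (incl p)) (fun i => (delta (ev_incl (q i)) (fun j => x (idx i j))).hom) := by
    rw [← Category.assoc, Iso.comp_inv_eq, ← h1]
    simp only [Category.assoc]
  have h2' : (delta (ev_incl (P.comp p' q')) x').hom =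
      (cellIso A (e p' q') (fun m => realize A (x' m))).hom ≫
        eqToHom (A.comp_act (incl p') (fun i => incl (q' i)) (fun m => realize A (x' m))) ≫
        A.actMap (𝟙 (incl p')) (fun i => (delta (ev_incl (q' i)) (fun j => x' (idx i j))).hom) ≫
        (delta (ev_incl p') (fun i => Kel.bind (q' i) (fun j => x' (idx i j)))).hom ≫
        eqToHom (congrArg (realize A) (Kel.bind_assoc p' q' x')) := by
    have := congrArg (· ≫ eqToHom (congrArg (realize A) (Kel.bind_assoc p' q' x'))) h2
    simpa only [Category.assoc, eqToHom_trans, eqToHom_refl, Category.comp_id] using this.symm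
  have h3 : A.actMap ((Wk P).compMap f g) h =
      eqToHom (A.comp_act _ _ _) ≫ A.actMap f (fun i => A.actMap (g i) (fun j => h (idx i j))) ≫
        eqToHom (A.comp_act _ _ _).symm :=
    (conj_eqToHom_iff_heq _ _ (A.comp_act _ _ _) (A.comp_act _ _ _)).2 (A.comp_actMap f g h)
  rw [Iso.inv_comp_eq, h2', reassoc_of% (cellIso_natural (e p q) (e p' q') F
    ((Wk P).compMap f g) h), h3]
  simp only [Category.assoc]
  rw [reassoc_of% h1']
  simp only [eqToHom_trans_assoc, eqToHom_refl, Category.id_comp]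
  rw [reassoc_of% (actMap_cells (A := A) (𝟙 (incl p)) f f),
    reassoc_of% (actMap_cells (A := A) f (𝟙 (incl p')) f)]
  simp only [Iso.hom_inv_id_assoc]

variable (A)

/-- The `D_* P`-algebra structure on the strictification of a weak `P`-category `A`. -/
def stAlg : Alg.{v, u} (Disc P) where
  carrier := StCarrier A
  act p x := Kel.bind p.as x
  actMap {n p p' x x'} f g := InducedCategory.homMk
    ((delta (ev_incl p.as) x).inv ≫
      A.actMap (cell (by rw [Discrete.eq_of_hom f])) (fun i => (g i).hom) ≫
      (delta (ev_incl p'.as) x').hom)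
  actMap_id p x := by
    refine InducedCategory.hom_ext ?_
    change (delta (ev_incl p.as) x).inv ≫ A.actMap (cell _) (fun i => 𝟙 (realize A (x i))) ≫
      (delta (ev_incl p.as) x).hom = 𝟙 (realize A (Kel.bind p.as x))
    rw [cell_uniq (cell _) (𝟙 (incl p.as)), A.actMap_id, Category.id_comp, Iso.inv_hom_id]
  actMap_comp f f' g g' := by
    refine InducedCategory.hom_ext ?_
    simp only [InducedCategory.homMk_hom, InducedCategory.comp_hom, Category.assoc,
      Iso.hom_inv_id_assoc]
    congr 1
    rw [← Category.assoc]
    congr 1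
    exact (actMap_cells _ _ _ _ _).symm
  one_act x := Kel.bind_one x
  one_actMap {x x'} g := realizeHom_heq _ _ (Kel.bind_one x) (Kel.bind_one x')
    (stAlg_one g _ (Kel.bind_one x) (Kel.bind_one x'))
  comp_act p q x := (Kel.bind_assoc p.as (fun i => (q i).as) x).symm
  comp_actMap {n k p p' q q' x x'} f g h := by
    refine realizeHom_heq _ _ (Kel.bind_assoc p.as (fun i => (q i).as) x).symm
      (Kel.bind_assoc p'.as (fun i => (q' i).as) x').symm ?_
    exact stAlg_comp p.as p'.as (fun i => (q i).as) (fun i => (q' i).as) _ _ _ x x'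
      (fun m => (h m).hom)

/-- The strictification `st A` of a weak `P`-category `A`. -/
def st : StrPCat.{v, u} P := ⟨stAlg A⟩

variable {A}

theorem delta_natural {n : ℕ} {q q' : (Wk P).Cell n} {p p' : P.Op n} (h : ev q = p)
    (h' : ev q' = p') (f : q ⟶ q') (f' : incl p ⟶ incl p') {x x' : Fin n → Kel P A.carrier}
    (g : ∀ i, realize A (x i) ⟶ realize A (x' i)) :
    A.actMap f g ≫ (delta h' x').hom =
      (delta h x).hom ≫ (delta (ev_incl p) x).inv ≫ A.actMap f' g ≫
        (delta (ev_incl p') x').hom := by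
  have e := cellIso_delta (A := A) (h.trans (ev_incl p).symm) (ev_incl p) x
  have e' := cellIso_delta (A := A) (h'.trans (ev_incl p').symm) (ev_incl p') x'
  rw [← e, ← e', Category.assoc, Iso.hom_inv_id_assoc, reassoc_of% (cellIso_natural (A := A)
    (h.trans (ev_incl p).symm) (h'.trans (ev_incl p').symm) f f' g)]

open Kel in
theorem delta_wkOne (x : Fin 1 → Kel P A.carrier)
    (h : A.act (Wk P).one (fun i => realize A (x i)) = realize A (bind P.one x)) :
    (delta (q := (Wk P).one) ev_one x).hom = eqToHom h := by
  refine IsCan.uniq (isCan_delta _ _) (IsCan.eqToHom' ?_ (val_bind (A := A) _ _).symm _)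
  exact (bind_one (R := (Wk P).cells) (fun i => hat (x i))).trans (congrArg hat (bind_one x)).symm

open Kel in
theorem delta_wkComp {n : ℕ} {k : Fin n → ℕ} (q : (Wk P).Cell n) (r : ∀ i, (Wk P).Cell (k i))
    (x : Fin (∑ i, k i) → Kel P A.carrier) {s : P.Op (∑ i, k i)}
    (hs : ev ((Wk P).comp q r) = s)
    (e : realize A (bind (ev q) (fun i => bind (ev (r i)) (fun j => x (idx i j)))) =
      realize A (bind s x)) :
    (delta hs x).hom = eqToHom (A.comp_act q r _) ≫
      A.actMap (𝟙 q) (fun i => (delta (q := r i) rfl (fun j => x (idx i j))).hom) ≫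
      (delta (q := q) rfl (fun i => bind (ev (r i)) (fun j => x (idx i j)))).hom ≫ eqToHom e := by
  subst hs
  refine IsCan.uniq (isCan_delta _ _) ?_
  refine IsCan.trans (IsCan.eqToHom (val_bind (A := A) _ _).symm _) ?_
  rw [← bind_assoc (R := (Wk P).cells)]
  refine IsCan.trans (IsCan.actMap _ (fun i => isCan_delta _ _)) ?_
  refine IsCan.trans (isCan_delta _ _) (IsCan.eqToHom' ?_ rfl _)
  rw [bind_assoc, ev_comp]

variable (A)

/-- The equivalence `(F, φ) : st A ⟶ A`: the functor `F` sends `(p, a₁, …, aₙ)` to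
`p(a₁, …, aₙ)` and is the identity on arrows, and the components of `φ` are components of `δ`. -/
def stEval : (st A).toWk ⟶ A where
  functor := inducedFunctor (realize A)
  coh q x := delta (q := q) rfl x
  coh_natural f g := delta_natural rfl rfl f _ (fun i => (g i).hom)
  coh_one x := delta_wkOne x _
  coh_comp q r x := by
    refine (delta_wkComp q r x rfl ?_).trans ?_
    · refine congrArg (realize A) ((Kel.bind_assoc (X := A.carrier) (ev q) (fun i => ev (r i))
        x).trans ?_)
      rw [ev_comp]
    · rfl

/-- The functor `F' : A ⟶ st A`, which sends `a` to `(1_P, a)` and `f` to the lifting of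
`1_P(f)`. -/
def stUnitFunctor : A.carrier ⥤ StCarrier A where
  obj a := ⟨1, P.one, fun _ => a⟩
  map f := InducedCategory.homMk (A.actMap (𝟙 (incl P.one)) (fun _ => f))
  map_id a := InducedCategory.hom_ext (A.actMap_id _ _)
  map_comp f g := InducedCategory.hom_ext (Alg.actMap_comp_id _ _)

/-- The isomorphism `q(1_P(a₁), …, 1_P(aₙ)) ≅ q(a₁, …, aₙ)`. -/
def actUnitIso {n : ℕ} (q : (Wk P).Cell n) (a : Fin n → A.carrier) :
    A.act q (fun i => A.act (incl P.one) (fun _ => a i)) ≅ A.act q a where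
  hom := A.actMap (𝟙 q) (fun i => (unitIso (a i)).hom)
  inv := A.actMap (𝟙 q) (fun i => (unitIso (a i)).inv)
  hom_inv_id := by
    rw [← Alg.actMap_comp_id]
    simp only [Iso.hom_inv_id]
    exact A.actMap_id _ _
  inv_hom_id := by
    rw [← Alg.actMap_comp_id]
    simp only [Iso.inv_hom_id]
    exact A.actMap_id _ _

/-- The coherence map `ψ`: the lifting to `st A` of the canonical isomorphism
`(q ∘ (1_P, …, 1_P))(a₁, …, aₙ) ≅ q(a₁, …, aₙ) ≅ 1_P(q(a₁, …, aₙ))`. -/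
def stUnitCoh {n : ℕ} (q : (Wk P).Cell n) (a : Fin n → A.carrier) :
    realize A (Kel.bind (ev q) (fun i => (stUnitFunctor A).obj (a i))) ≅
      realize A ((stUnitFunctor A).obj (A.act q a)) :=
  (delta (q := q) rfl (fun i => (stUnitFunctor A).obj (a i))).symm ≪≫ actUnitIso A q a ≪≫
    (unitIso (A.act q a)).symm

variable {A}

theorem realizeHom_eqToHom {x y : StCarrier A} (h : x = y) :
    (eqToHom h : x ⟶ y).hom = eqToHom (congrArg (realize A) h) := by
  subst h; rfl

theorem Kel.bind_leaf {R : PlainOperad.{u}} {X : Type u} {n : ℕ} (q : R.Op n) (a : Fin n → X) :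
    Kel.bind q (fun i => ⟨1, R.one, fun _ => a i⟩) = (⟨n, q, a⟩ : Kel R X) := by
  refine Kel.ext' (sum_one n) (R.comp_one q) fun m => ?_
  obtain ⟨i, j, rfl⟩ := idx_surj m
  change Kel.flatten (fun i (_ : Fin 1) => a i) (idx i j) = a _
  rw [Kel.flatten_idx]
  congr 1
  ext
  obtain rfl : j = 0 := Subsingleton.elim _ _
  refine Eq.trans ?_ (idx_val' (k := fun _ : Fin n => 1) i 0).symm
  rw [← Finset.sum_filter, Finset.sum_const, smul_eq_mul, mul_one, Finset.filter_gt_eq_Iio,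
    Fin.card_Iio]
  rfl

open Kel in
theorem isCan_actUnitIso {n : ℕ} (q : (Wk P).Cell n) (a : Fin n → A.carrier) :
    IsCan (bind (R := (Wk P).cells) q (fun i => hat ((stUnitFunctor A).obj (a i)))) ⟨n, q, a⟩
      (actUnitIso A q a).hom := by
  rw [← bind_leaf (R := (Wk P).cells) q a]
  refine IsCan.actMap _ (fun i => ?_)
  have h := isCan_unitIso (A := A) (val_one (A := A) (a i)).symm
  rwa [bind_leaf (R := (Wk P).cells)] at h

theorem iso_square {C : Type w} [Category.{w'} C] {X X' Y Y' Z Z' W W' : C} (d : X ≅ Y)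
    (d' : X' ≅ Y') (e : W ≅ Z) (e' : W' ≅ Z') {m : X ⟶ X'} {t : Y ⟶ Y'} {k : X ⟶ Z} {k' : X' ⟶ Z'}
    {l : Z ⟶ Z'} {n : W ⟶ W'} (h : m ≫ d'.hom = d.hom ≫ t) (h' : m ≫ k' = k ≫ l)
    (h'' : n ≫ e'.hom = e.hom ≫ l) :
    t ≫ d'.inv ≫ k' ≫ e'.inv = (d.inv ≫ k ≫ e.inv) ≫ n := by
  have ht : t = d.inv ≫ m ≫ d'.hom := ((Iso.inv_comp_eq _).2 h).symm
  have hn : n = e.hom ≫ l ≫ e'.inv := by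
    rw [← Category.assoc, ← h'', Category.assoc, Iso.hom_inv_id, Category.comp_id]
  rw [ht, hn]
  simp only [Category.assoc, Iso.hom_inv_id_assoc, Iso.inv_hom_id_assoc]
  rw [reassoc_of% h']

theorem iso_triple {C : Type w} [Category.{w'} C] {X X' Y Y' Z Z' : C} (d : X ≅ Y)
    (d' : X' ≅ Y') {m : X ⟶ X'} {t : Y ⟶ Y'} {W : C} (k : X' ⟶ Z) (l : Z ⟶ Z')
    (z : Z' ⟶ W) (h : m ≫ d'.hom = d.hom ≫ t) :
    d.inv ≫ m ≫ k ≫ l ≫ z = t ≫ (d'.inv ≫ k ≫ l) ≫ z := by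
  have ht : t = d.inv ≫ m ≫ d'.hom := ((Iso.inv_comp_eq _).2 h).symm
  rw [ht]
  simp only [Category.assoc, Iso.hom_inv_id_assoc]

theorem stUnitCoh_natural {n : ℕ} {q q' : (Wk P).Cell n} {a a' : Fin n → A.carrier}
    (f : q ⟶ q') (f' : incl (ev q) ⟶ incl (ev q')) (g : ∀ i, a i ⟶ a' i) :
    ((delta (ev_incl (ev q)) (fun i => (stUnitFunctor A).obj (a i))).inv ≫
      A.actMap f' (fun i => A.actMap (𝟙 (incl P.one)) (fun _ => g i)) ≫
      (delta (ev_incl (ev q')) (fun i => (stUnitFunctor A).obj (a' i))).hom) ≫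
        (stUnitCoh A q' a').hom =
      (stUnitCoh A q a).hom ≫ A.actMap (𝟙 (incl P.one)) (fun _ => A.actMap f g) := by
  have h1 := delta_natural (A := A) (q := q) (q' := q') rfl rfl f f'
    (x := fun i => (stUnitFunctor A).obj (a i)) (x' := fun i => (stUnitFunctor A).obj (a' i))
    (fun i => A.actMap (𝟙 (incl P.one)) (fun _ => g i))
  have h3 : ∀ i, A.actMap (𝟙 (incl P.one)) (fun _ => g i) ≫ (unitIso (a' i)).hom =
      (unitIso (a i)).hom ≫ g i := fun i => unitIso_natural (g i) _
  have h4 := unitIso_natural (A.actMap f g) (𝟙 (incl P.one))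
  have h5 : A.actMap f (fun i => A.actMap (𝟙 (incl P.one)) (fun _ => g i)) ≫
      (actUnitIso A q' a').hom = (actUnitIso A q a).hom ≫ A.actMap f g := by
    simp only [actUnitIso]
    rw [actMap_cells _ _ f, actMap_cells _ _ f]
    exact congrArg (A.actMap f) (funext h3)
  exact iso_square _ _ _ _ h1 h5 h4

theorem realizeHom_comp {x x' y z z' : StCarrier A} (h : x = x') (f : x' ⟶ y) (g : y ⟶ z)
    (h' : z = z') : (eqToHom h ≫ f ≫ g ≫ eqToHom h').hom =
      eqToHom (congrArg (realize A) h) ≫ f.hom ≫ g.hom ≫ eqToHom (congrArg (realize A) h') := by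
  subst h h'
  simp

open Kel in
theorem isCan_stUnitCoh {n : ℕ} (q : (Wk P).Cell n) (a : Fin n → A.carrier)
    {x : WKel P A.carrier} (hx : A.act q a = val x) (hq : x = ⟨n, q, a⟩) :
    IsCan (hat (bind (ev q) (fun i => (stUnitFunctor A).obj (a i))))
      (bind (R := (Wk P).cells) (incl P.one) (fun _ => x)) (stUnitCoh A q a).hom := by
  subst hq
  refine IsCan.trans (IsCan.inv (isCan_delta (q := q) rfl
    (fun i => (stUnitFunctor A).obj (a i))) (Iso.inv_hom_id _)) ?_
  refine IsCan.trans ?_ (IsCan.inv (isCan_unitIso hx) (Iso.hom_inv_id _))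
  exact isCan_actUnitIso q a

open Kel in
theorem stUnitCoh_one (a : Fin 1 → A.carrier)
    (h : realize A (bind (ev (Wk P).one) (fun i => (stUnitFunctor A).obj (a i))) =
      realize A ((stUnitFunctor A).obj (A.act (Wk P).one a))) :
    (stUnitCoh A (Wk P).one a).hom = eqToHom h := by
  refine IsCan.uniq (isCan_stUnitCoh _ _ (x := ⟨1, (Wk P).one, a⟩) rfl rfl) ?_
  refine IsCan.eqToHom' ?_ rfl _
  have h1 : bind P.one (fun i => (stUnitFunctor A).obj (a i)) = (stUnitFunctor A).obj (a 0) :=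
    bind_one (fun i => (stUnitFunctor A).obj (a i))
  have h2 : (fun _ : Fin 1 => a 0) = a := funext fun i => by rw [Subsingleton.elim i 0]
  have h3 := bind_leaf (R := (Wk P).cells) (incl P.one) (fun _ => a 0)
  rw [h2] at h3
  rw [ev_one, h1]
  refine Eq.trans ?_ h3.symm
  rw [← h2]
  rfl

open Kel in
theorem stUnitCoh_comp {n : ℕ} {k : Fin n → ℕ} (q : (Wk P).Cell n) (r : ∀ i, (Wk P).Cell (k i))
    (a : Fin (∑ i, k i) → A.carrier) (f : incl (ev q) ⟶ incl (ev q))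
    (h : realize A (bind (ev ((Wk P).comp q r)) (fun m => (stUnitFunctor A).obj (a m))) =
      realize A (bind (ev q) (fun i => bind (ev (r i))
        (fun j => (stUnitFunctor A).obj (a (idx i j))))))
    (h' : realize A ((stUnitFunctor A).obj (A.act q (fun i => A.act (r i) (fun j => a (idx i j))))) =
      realize A ((stUnitFunctor A).obj (A.act ((Wk P).comp q r) a))) :
    (stUnitCoh A ((Wk P).comp q r) a).hom = eqToHom h ≫
      ((delta (ev_incl (ev q)) (fun i => bind (ev (r i))
        (fun j => (stUnitFunctor A).obj (a (idx i j))))).inv ≫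
        A.actMap f (fun i => (stUnitCoh A (r i) (fun j => a (idx i j))).hom) ≫
        (delta (ev_incl (ev q)) (fun i =>
          (stUnitFunctor A).obj (A.act (r i) (fun j => a (idx i j))))).hom) ≫
      (stUnitCoh A q (fun i => A.act (r i) (fun j => a (idx i j)))).hom ≫ eqToHom h' := by
  let y : Fin n → WKel P A.carrier := fun i => ⟨k i, r i, fun j => a (idx i j)⟩
  have hy : bind (R := (Wk P).cells) q y = ⟨∑ i, k i, (Wk P).comp q r, a⟩ := by
    simp [y, Kel.bind, flatten_eta]
  have e := iso_triple _ _ (actUnitIso A q (fun i => A.act (r i) (fun j => a (idx i j)))).hom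
    (unitIso (A.act q (fun i => A.act (r i) (fun j => a (idx i j))))).inv (eqToHom h')
    (delta_natural (A := A) (q := q) (q' := q) rfl rfl (𝟙 q) f
      (x := fun i => bind (ev (r i)) (fun j => (stUnitFunctor A).obj (a (idx i j))))
      (x' := fun i => (stUnitFunctor A).obj (A.act (r i) (fun j => a (idx i j))))
      (fun i => (stUnitCoh A (r i) (fun j => a (idx i j))).hom))
  refine Eq.trans ?_ (congrArg (fun m => eqToHom h ≫ m) e)
  refine IsCan.uniq (isCan_stUnitCoh _ _ (x := ⟨_, (Wk P).comp q r, a⟩) rfl rfl) ?_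
  have hb : bind (ev ((Wk P).comp q r)) (fun m => (stUnitFunctor A).obj (a m)) =
      bind (ev q) (fun i => bind (ev (r i)) (fun j => (stUnitFunctor A).obj (a (idx i j)))) := by
    rw [ev_comp]
    exact (bind_assoc (ev q) (fun i => ev (r i)) (fun m => (stUnitFunctor A).obj (a m))).symm
  refine IsCan.trans (IsCan.eqToHom' (congrArg hat hb) rfl h) ?_
  refine IsCan.trans (IsCan.inv (isCan_delta (q := q) rfl _) (Iso.inv_hom_id _)) ?_
  refine IsCan.trans (IsCan.actMap (𝟙 q) fun i =>
    isCan_stUnitCoh (r i) (fun j => a (idx i j)) (x := y i) rfl rfl) ?_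
  refine IsCan.trans (IsCan.actMap (𝟙 q) fun i => isCan_unitIso (y := y i) rfl) ?_
  refine IsCan.trans (IsCan.inv (isCan_unitIso (val_bind (A := A) q y).symm)
    (Iso.inv_hom_id _)) (IsCan.eqToHom' (by rw [hy]) ?_ h')
  rw [val_bind, val_bind]
  rfl

variable (A)

/-- The weak `P`-functor `(F', ψ) : A ⟶ st A`. -/
def stUnit : A ⟶ (st A).toWk where
  functor := stUnitFunctor A
  coh q a := InducedCategory.isoMk (stUnitCoh A q a)
  coh_natural f g := by
    refine InducedCategory.hom_ext ?_
    exact stUnitCoh_natural f _ g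
  coh_one a := by
    refine InducedCategory.hom_ext ?_
    refine Eq.trans ?_ (realizeHom_eqToHom _).symm
    exact stUnitCoh_one a _
  coh_comp q r a := by
    refine InducedCategory.hom_ext ?_
    refine Eq.trans ?_ (realizeHom_comp _ _ _ _).symm
    exact stUnitCoh_comp q r a _ _ _

end Strictification

/-- A strict 2-functor `J`, regarded as the inclusion of a sub-2-category, exhibits `B` as a weakly
coreflective sub-2-category of `C`: it is injective on objects, 1-cells and 2-cells, and between
the underlying 1-categories it has a left adjoint such that every component of the unit is an
equivalence in the 2-category `C`. -/
structure IsWeaklyCoreflective {B : Type w} [Bicategory.{v, w'} B] [Bicategory.Strict B]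
    {C : Type w₁} [Bicategory.{v, w₁'} C] [Bicategory.Strict C]
    (J : StrictPseudofunctor B C) : Prop where
  obj_injective : Function.Injective J.obj
  map_injective : ∀ (a b : B) (f g : a ⟶ b), J.map f = J.map g → f = g
  map₂_injective : ∀ (a b : B) (f g : a ⟶ b) (σ τ : f ⟶ g), J.map₂ σ = J.map₂ τ → σ = τ
  exists_leftAdjoint : ∃ (L : C ⥤ B) (adj : L ⊣ J.toFunctor),
    ∀ c : C, ∃ e : Bicategory.Equivalence c (J.obj (L.obj c)), e.hom = adj.unit.app c

end OperadCoherence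

/-!
A weak `P`-functor `H : A ⟶ U' S` into a strict `P`-category extends along `(F', ψ) : A ⟶ U' (st A)`
to exactly one strict `P`-functor `K : st A ⟶ S`, and this universal property is the adjunction
between `st` and `U'`.

For existence (`liftHom`), start from the weak `P`-functor `U' (st A) ⟶ A ⟶ U' S`, which sends
`(p, a₁, …, aₙ)` to `H (p(a₁, …, aₙ))`, and move its object part along the coherence isomorphisms
of `H` to `p(H a₁, …, H aₙ)`. Any weak map can be transported along isomorphisms in this way
(`WeakHom.copyObj`), so the axioms of a weak `P`-functor need not be checked again; only strictness
remains. It holds because the coherence map of `H` at `q ∘ (p₁, …, pₙ)` is composed of those at `q`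
and at the `pᵢ`, while naturality in the 2-cells of `Wk P`, which act on `S` by identities,
identifies it with the one at `ε(q) ∘ (p₁, …, pₙ)` (`liftIso_bind`).

For uniqueness (`stUnit_comp_injective`), every object `(p, a₁, …, aₙ)` of `st A` is
`p · (F' a₁, …, F' aₙ)`, and every arrow of `st A` between such objects has the form
`ψ ≫ F' f ≫ ψ⁻¹`, since `F'` is full. The image under a strict `K` of a component of `ψ` is a
coherence map of the composite of `(F', ψ)` with `K`, so `K` is determined by that composite.

The canonical isomorphisms `1_P(a) ≅ a` are the components of invertible `P`-transformations which
make `(F', ψ)` and `(F, φ)` pseudo-inverse (`stUnitEvalIso`, `stEvalUnitIso`); correcting the second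
of these transformations gives an adjoint equivalence. Finally, `U'`
is injective on objects because evaluation of trees is surjective on 1-cells and on 2-cells.
-/

namespace OperadCoherence

/-! ### Transport of weak maps along isomorphisms -/

section WeakMaps

variable {Q : CatOperad.{w, w'}}

theorem Alg.one_actMap_eq (A : Alg.{v, u} Q) {a a' : Fin 1 → A.carrier} (g : ∀ i, a i ⟶ a' i) :
    A.actMap (𝟙 Q.one) g = eqToHom (A.one_act a) ≫ g 0 ≫ eqToHom (A.one_act a').symm :=
  (conj_eqToHom_iff_heq _ _ (A.one_act a) (A.one_act a')).2 (A.one_actMap g)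

theorem Alg.comp_actMap_eq (A : Alg.{v, u} Q) {n : ℕ} {k : Fin n → ℕ} {q q' : Q.Cell n}
    {r r' : ∀ i, Q.Cell (k i)} {a a' : Fin (∑ i, k i) → A.carrier}
    (f : q ⟶ q') (g : ∀ i, r i ⟶ r' i) (h : ∀ m, a m ⟶ a' m) :
    A.actMap (Q.compMap f g) h = eqToHom (A.comp_act q r a) ≫
      A.actMap f (fun i => A.actMap (g i) (fun j => h (idx i j))) ≫
        eqToHom (A.comp_act q' r' a').symm :=
  (conj_eqToHom_iff_heq _ _ (A.comp_act q r a) (A.comp_act q' r' a')).2 (A.comp_actMap f g h)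

/-- The isomorphism `q(a₁, …, aₙ) ≅ q(a'₁, …, a'ₙ)` induced by isomorphisms `aᵢ ≅ a'ᵢ`. -/
def Alg.actIso (A : Alg.{v, u} Q) {n : ℕ} (q : Q.Cell n) {a a' : Fin n → A.carrier}
    (e : ∀ i, a i ≅ a' i) : A.act q a ≅ A.act q a' where
  hom := A.actMap (𝟙 q) (fun i => (e i).hom)
  inv := A.actMap (𝟙 q) (fun i => (e i).inv)
  hom_inv_id := by
    rw [← Alg.actMap_comp_id]
    simpa only [Iso.hom_inv_id] using A.actMap_id q a
  inv_hom_id := by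
    rw [← Alg.actMap_comp_id]
    simpa only [Iso.inv_hom_id] using A.actMap_id q a'

section CopyObj

variable {A B : Alg.{v, u} Q} (F : WeakHom A B) (obj : A.carrier → B.carrier)
  (e : ∀ a, F.functor.obj a ≅ obj a)

/-- The coherence maps of `F`, transported along isomorphisms `F a ≅ obj a`. -/
def WeakHom.copyObjCoh {n : ℕ} (q : Q.Cell n) (a : Fin n → A.carrier) :
    B.act q (fun i => obj (a i)) ≅ obj (A.act q a) :=
  B.actIso q (fun i => (e (a i)).symm) ≪≫ F.coh q a ≪≫ e (A.act q a)

theorem WeakHom.copyObjCoh_hom {n : ℕ} (q : Q.Cell n) (a : Fin n → A.carrier) :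
    (F.copyObjCoh obj e q a).hom =
      B.actMap (𝟙 q) (fun i => (e (a i)).inv) ≫ (F.coh q a).hom ≫ (e (A.act q a)).hom := rfl

theorem WeakHom.copyObjCoh_natural {n : ℕ} {q q' : Q.Cell n} {a a' : Fin n → A.carrier}
    (f : q ⟶ q') (g : ∀ i, a i ⟶ a' i) :
    B.actMap f (fun i => (e (a i)).inv ≫ F.functor.map (g i) ≫ (e (a' i)).hom) ≫
        (F.copyObjCoh obj e q' a').hom =
      (F.copyObjCoh obj e q a).hom ≫
        (e (A.act q a)).inv ≫ F.functor.map (A.actMap f g) ≫ (e (A.act q' a')).hom := by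
  have h : B.actMap f (fun i => (e (a i)).inv ≫ F.functor.map (g i) ≫ (e (a' i)).hom) ≫
      B.actMap (𝟙 q') (fun i => (e (a' i)).inv) =
      B.actMap (𝟙 q) (fun i => (e (a i)).inv) ≫ B.actMap f (fun i => F.functor.map (g i)) := by
    rw [← B.actMap_comp, ← B.actMap_comp, Category.id_comp, Category.comp_id]
    simp
  simp only [copyObjCoh_hom, Category.assoc, Iso.hom_inv_id_assoc]
  rw [reassoc_of% h, reassoc_of% F.coh_natural f g]

theorem WeakHom.copyObj_hom_eqToHom {a a' : A.carrier} (h : a = a') :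
    (e a).hom ≫ eqToHom (congrArg obj h) =
      eqToHom (congrArg F.functor.obj h) ≫ (e a').hom := by
  subst h
  simp

theorem WeakHom.copyObjCoh_one (a : Fin 1 → A.carrier) :
    (F.copyObjCoh obj e Q.one a).hom =
      eqToHom ((B.one_act _).trans (congrArg obj (A.one_act a).symm)) := by
  have h := F.copyObj_hom_eqToHom obj e (A.one_act a).symm
  rw [copyObjCoh_hom, Alg.one_actMap_eq, F.coh_one]
  simp only [Category.assoc, eqToHom_trans_assoc]
  rw [← h]
  simp

theorem WeakHom.copyObjCoh_comp {n : ℕ} {k : Fin n → ℕ} (q : Q.Cell n)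
    (r : ∀ i, Q.Cell (k i)) (a : Fin (∑ i, k i) → A.carrier) :
    (F.copyObjCoh obj e (Q.comp q r) a).hom =
      eqToHom (B.comp_act q r _) ≫
        B.actMap (𝟙 q) (fun i => (F.copyObjCoh obj e (r i) (fun j => a (idx i j))).hom) ≫
        (F.copyObjCoh obj e q (fun i => A.act (r i) (fun j => a (idx i j)))).hom ≫
        eqToHom (congrArg obj (A.comp_act q r a).symm) := by
  have h := B.comp_actMap_eq (𝟙 q) (fun i => 𝟙 (r i)) (fun m => (e (a m)).inv)
  rw [Q.compMap_id] at h
  have h' : B.actMap (𝟙 q) (fun i => (e (A.act (r i) fun j => a (idx i j))).hom) ≫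
      B.actMap (𝟙 q) (fun i => (e (A.act (r i) fun j => a (idx i j))).inv) = 𝟙 _ :=
    (B.actIso q fun i => e (A.act (r i) fun j => a (idx i j))).hom_inv_id
  simp only [copyObjCoh_hom, h, F.coh_comp, Alg.actMap_comp_id, Category.assoc,
    eqToHom_trans_assoc, eqToHom_refl, Category.id_comp,
    F.copyObj_hom_eqToHom obj e (A.comp_act q r a).symm]
  rw [reassoc_of% h']

/-- A weak map may be replaced by one with a prescribed isomorphic object part: both its arrow
part and its coherence maps are transported along the isomorphisms. -/
def WeakHom.copyObj : WeakHom A B where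
  functor := F.functor.copyObj obj e
  coh := F.copyObjCoh obj e
  coh_natural := F.copyObjCoh_natural obj e
  coh_one := F.copyObjCoh_one obj e
  coh_comp := F.copyObjCoh_comp obj e

end CopyObj

end WeakMaps

/-! ### The strict extension of a weak functor -/

section Lift

variable {P : PlainOperad.{u}} {A : WkPCat.{v, u} P} {S : StrPCat.{v, u} P}

theorem StrPCat.toWk_act (S : StrPCat.{v, u} P) {n : ℕ} {q q' : (Wk P).Cell n} (h : ev q = ev q')
    (a : Fin n → S.toWk.carrier) : S.toWk.act q a = S.toWk.act q' a :=
  congrArg (fun p : P.Op n => S.toAlg.act (n := n) (Discrete.mk p) a) h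

/-- On a strict `P`-category, the 2-cells of `Wk P` act by identities. -/
theorem StrPCat.toWk_actMap (S : StrPCat.{v, u} P) {n : ℕ} {q q' : (Wk P).Cell n} (f : q ⟶ q')
    (a : Fin n → S.toWk.carrier) :
    S.toWk.actMap f (fun i => 𝟙 (a i)) = eqToHom (S.toWk_act (ev_eq f) a) := by
  have key : ∀ {p p' : Discrete (P.Op n)} (g : p ⟶ p') (h : S.toAlg.act p a = S.toAlg.act p' a),
      S.toAlg.actMap g (fun i => 𝟙 (a i)) = eqToHom h := by
    rintro ⟨p⟩ ⟨p'⟩ g h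
    obtain rfl : p = p' := Discrete.eq_of_hom g
    rw [Subsingleton.elim g (𝟙 _)]
    exact S.toAlg.actMap_id _ _
  exact key _ _

/-- On the blocks `xᵢ = (pᵢ, C_{i1}, …, C_{ik_i})` of one list `C`, the isomorphism `delta` is,
up to identities, the component at `C` of a 2-cell of `Wk P`. -/
theorem delta_blocks {n : ℕ} {k : Fin n → ℕ} (q : (Wk P).Cell n) (p : ∀ i, P.Op (k i))
    (C : Fin (∑ i, k i) → A.carrier)
    (h : realize A ⟨_, P.comp (ev q) p, C⟩ =
      realize A (Kel.bind (ev q) fun i => ⟨k i, p i, fun j => C (idx i j)⟩)) :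
    (delta (q := q) rfl (fun i => (⟨k i, p i, fun j => C (idx i j)⟩ : Kel P A.carrier))).hom =
      eqToHom (A.comp_act q (fun i => incl (p i)) C).symm ≫
        A.actMap (cell (ev_delta (q := q) rfl p)) (fun m => 𝟙 (C m)) ≫ eqToHom h := by
  have key : ∀ (D : Fin (∑ i, k i) → A.carrier) (_ : D = C)
      (h₁ : A.act q (fun i => A.act (incl (p i)) (fun j => C (idx i j))) =
        A.act ((Wk P).comp q (fun i => incl (p i))) D)
      (h₂ : A.act (incl (P.comp (ev q) p)) C = A.act (incl (P.comp (ev q) p)) D),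
      eqToHom h₁ ≫ A.actMap (cell (ev_delta (q := q) rfl p)) (fun m => 𝟙 (D m)) =
        eqToHom (A.comp_act q (fun i => incl (p i)) C).symm ≫
          A.actMap (cell (ev_delta (q := q) rfl p)) (fun m => 𝟙 (C m)) ≫ eqToHom h₂ := by
    rintro _ rfl h₁ h₂
    simp
  exact key _ (Kel.flatten_eta C)
    (act_realize A q fun i => ⟨k i, p i, fun j => C (idx i j)⟩) h

theorem map_conj_eqToHom {C : Type w} [Category.{w'} C] {D : Type w₁} [Category.{w₁'} D]
    (F : C ⥤ D) {X X' Y Y' : C} (h : X = X') (f : X' ⟶ Y') (h' : Y' = Y) :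
    F.map (eqToHom h ≫ f ≫ eqToHom h') =
      eqToHom (congrArg F.obj h) ≫ F.map f ≫ eqToHom (congrArg F.obj h') := by
  subst h h'
  simp

/-- Pasting of squares that commute up to identities, in the shape needed for `liftIso_bind`. -/
theorem conj_eqToHom_square {C : Type w} [Category.{w'} C] {X Y Z W X₁ Z₁ W₁ V₁ V : C}
    {u : X ⟶ Y} {c : Y ⟶ Z} {d : Z ⟶ W} {m : X₁ ⟶ Z₁} {t : Z₁ ⟶ W₁} {k : V₁ ⟶ W₁} {l : V ⟶ W}
    {h₁ : X = X₁} {h₂ : Z₁ = Z} {h₃ : Z = Z₁} {h₄ : W₁ = W} {h₅ : X₁ = V₁} {h₆ : V = V₁}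
    {h₇ : X = V} (hc : u ≫ c = eqToHom h₁ ≫ m ≫ eqToHom h₂)
    (hd : d = eqToHom h₃ ≫ t ≫ eqToHom h₄) (hn : eqToHom h₅ ≫ k = m ≫ t)
    (hl : l = eqToHom h₆ ≫ k ≫ eqToHom h₄) : u ≫ c ≫ d = eqToHom h₇ ≫ l := by
  subst h₁ h₂ h₄ h₆ h₇ hl hd
  simp only [eqToHom_refl, Category.id_comp, Category.comp_id] at hc hn ⊢
  rw [reassoc_of% hc, hn]

/-- The object part of the strict `P`-functor `st A ⟶ S` induced by a weak `P`-functor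
`H : A ⟶ U' S`: it sends `(p, a₁, …, aₙ)` to `p(H a₁, …, H aₙ)`. -/
def liftObj (H : A ⟶ S.toWk) (x : Kel P A.carrier) : S.toWk.carrier :=
  S.toWk.act (incl x.op) (fun i => H.functor.obj (x.args i))

/-- The isomorphism `H (p(a₁, …, aₙ)) ≅ p(H a₁, …, H aₙ)`. -/
def liftIso (H : A ⟶ S.toWk) (x : Kel P A.carrier) :
    H.functor.obj (realize A x) ≅ liftObj H x :=
  (H.coh (incl x.op) x.args).symm

/-- The weak `P`-functor `st A ⟶ A ⟶ U' S`, with its object part changed to `liftObj H`. -/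
def liftHom (H : A ⟶ S.toWk) : (st A).toWk ⟶ S.toWk :=
  WeakHom.copyObj (stEval A ≫ H) (liftObj H) (liftIso H)

theorem liftObj_bind (H : A ⟶ S.toWk) {n : ℕ} (q : (Wk P).Cell n) (x : Fin n → Kel P A.carrier) :
    S.toWk.act q (fun i => liftObj H (x i)) = liftObj H (Kel.bind (ev q) x) := by
  have h := act_realize S.toWk q
    (fun i => ⟨(x i).arity, (x i).op, fun j => H.functor.obj ((x i).args j)⟩)
  refine (h.trans (S.toWk_act (ev_delta rfl _) _)).trans ?_
  rfl

/-- The isomorphisms `liftIso H` intertwine the coherence maps of `st A ⟶ A ⟶ U' S` with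
identities, so that the coherence maps of `liftHom H` are identities. -/
theorem liftIso_bind (H : A ⟶ S.toWk) {n : ℕ} (q : (Wk P).Cell n) (x : Fin n → Kel P A.carrier) :
    S.toWk.actMap (𝟙 q) (fun i => (liftIso H (x i)).inv) ≫
      (H.coh q (fun i => realize A (x i))).hom ≫ H.functor.map (delta (q := q) rfl x).hom =
    eqToHom (liftObj_bind H q x) ≫ (liftIso H (Kel.bind (ev q) x)).inv := by
  -- write the lists in the arguments `x i` as the blocks of one list `C`
  choose k p a hx using fun i => (⟨_, _, _, rfl⟩ : ∃ k p a, x i = (⟨k, p, a⟩ : Kel P A.carrier))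
  obtain ⟨C, rfl⟩ : ∃ C : Fin (∑ i, k i) → A.carrier, a = fun i j => C (idx i j) :=
    ⟨Kel.flatten a, by funext i j; simp⟩
  obtain rfl : x = fun i => ⟨k i, p i, fun j => C (idx i j)⟩ := funext hx
  have hb : Kel.bind (ev q) (fun i => ⟨k i, p i, fun j => C (idx i j)⟩) =
      (⟨_, P.comp (ev q) p, C⟩ : Kel P A.carrier) := by
    simp [Kel.bind, Kel.flatten_eta]
  have hl : ∀ {y z : Kel P A.carrier} (e : y = z), (liftIso H y).inv =
      eqToHom (congrArg (liftObj H) e) ≫ (liftIso H z).inv ≫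
        eqToHom (congrArg (fun y => H.functor.obj (realize A y)) e.symm) := by
    rintro _ _ rfl
    simp
  have hc : S.toWk.actMap (𝟙 q) (fun i => (H.coh (incl (p i)) (fun j => C (idx i j))).hom) ≫
      (H.coh q (fun i => A.act (incl (p i)) (fun j => C (idx i j)))).hom =
      eqToHom (S.toWk.comp_act q (fun i => incl (p i)) _).symm ≫
        (H.coh ((Wk P).comp q (fun i => incl (p i))) C).hom ≫
        eqToHom (congrArg H.functor.obj (A.comp_act q _ C)) := by
    rw [H.coh_comp]
    simp
  -- naturality of the coherence maps in the 2-cell from `q ∘ (p₁, …, pₙ)` to `ε(q) ∘ (p₁, …, pₙ)`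
  have hn : eqToHom (S.toWk_act (ev_delta (q := q) rfl p) _) ≫
      (H.coh (incl (P.comp (ev q) p)) C).hom =
      (H.coh ((Wk P).comp q (fun i => incl (p i))) C).hom ≫
        H.functor.map (A.actMap (cell (ev_delta (q := q) rfl p)) (fun m => 𝟙 (C m))) := by
    rw [← H.coh_natural, ← StrPCat.toWk_actMap S (cell (ev_delta (q := q) rfl p))]
    exact congrArg (S.toWk.actMap (cell _) · ≫ _)
      (funext fun m => (H.functor.map_id (C m)).symm)
  have hd := (congrArg H.functor.map
    (delta_blocks q p C (congrArg (realize A) hb.symm))).trans (map_conj_eqToHom _ _ _ _)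
  exact conj_eqToHom_square hc hd hn (hl hb)

theorem isStrict_liftHom (H : A ⟶ S.toWk) : WeakHom.IsStrict (liftHom H) := by
  intro n q x
  refine ⟨liftObj_bind H q x, ?_⟩
  have h := liftIso_bind H q x
  have h' := congrArg (· ≫ (liftIso H (Kel.bind (ev q) x)).hom) h
  simp only [Category.assoc, Iso.inv_hom_id, Category.comp_id] at h'
  refine Eq.trans ?_ h'
  show S.toWk.actMap (𝟙 q) (fun i => (liftIso H (x i)).inv) ≫
    ((H.coh q (fun i => realize A (x i))).hom ≫ H.functor.map (delta (q := q) rfl x).hom) ≫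
      (liftIso H (Kel.bind (ev q) x)).hom = _
  exact congrArg (S.toWk.actMap (𝟙 q) (fun i => (liftIso H (x i)).inv) ≫ ·)
    (Category.assoc _ _ _)

end Lift

/-! ### The extension property -/

section UniversalProperty

variable {P : PlainOperad.{u}} {A : WkPCat.{v, u} P} {S : StrPCat.{v, u} P}

theorem liftObj_unit (H : A ⟶ S.toWk) (a : A.carrier) :
    S.toWk.act (incl P.one) (fun _ => H.functor.obj a) = H.functor.obj a :=
  (S.toWk_act ev_incl_one _).trans (S.toWk.one_act _)

/-- The coherence map of `H` at `1_P` is, up to an identity, the image of `a ≅ 1_P(a)`. -/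
theorem coh_incl_one (H : A ⟶ S.toWk) (a : A.carrier) :
    (H.coh (incl P.one) (fun _ => a)).hom =
      eqToHom (liftObj_unit H a) ≫ H.functor.map (unitIso a).inv := by
  have h := H.coh_natural (cell ev_incl_one.symm) (fun _ => 𝟙 a)
  have h₁ : S.toWk.actMap (cell ev_incl_one.symm) (fun _ : Fin 1 => H.functor.map (𝟙 a)) =
      eqToHom (S.toWk_act ev_incl_one.symm _) :=
    (congrArg (S.toWk.actMap (cell _)) (funext fun _ => H.functor.map_id a)).trans
      (S.toWk_actMap _ _)
  have h₂ : (unitIso a).inv = eqToHom (A.one_act (fun _ => a)).symm ≫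
      A.actMap (cell ev_incl_one.symm) (fun _ => 𝟙 a) := rfl
  rw [h₁, H.coh_one] at h
  rw [h₂, Functor.map_comp, eqToHom_map]
  have h₃ := congrArg (eqToHom (S.toWk_act ev_incl_one _) ≫ ·) h
  simpa using h₃

theorem coh_incl_one_inv (H : A ⟶ S.toWk) (a : A.carrier) :
    (H.coh (incl P.one) (fun _ => a)).inv =
      H.functor.map (unitIso a).hom ≫ eqToHom (liftObj_unit H a).symm := by
  rw [← cancel_epi (H.coh (incl P.one) (fun _ => a)).hom, Iso.hom_inv_id, coh_incl_one,
    Category.assoc, ← H.functor.map_comp_assoc]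
  simp

/-- On arrows, the composite of `(F', ψ)` with `liftHom H` agrees with `H`. -/
theorem stUnit_liftHom_map (H : A ⟶ S.toWk) {a b : A.carrier} (f : a ⟶ b) :
    (H.coh (incl P.one) (fun _ => a)).hom ≫
      H.functor.map (A.actMap (𝟙 (incl P.one)) (fun _ => f)) ≫
        (H.coh (incl P.one) (fun _ => b)).inv =
      eqToHom (liftObj_unit H a) ≫ H.functor.map f ≫ eqToHom (liftObj_unit H b).symm := by
  rw [coh_incl_one, coh_incl_one_inv, Category.assoc, ← H.functor.map_comp_assoc,
    ← H.functor.map_comp_assoc, Category.assoc,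
    unitIso_natural, Iso.inv_hom_id_assoc]

/-- The coherence maps of the composite of `(F', ψ)` with `liftHom H` agree with those of `H`. In
the composite, the isomorphism `delta` in the coherence map of `st A ⟶ A` cancels its inverse in
`ψ`, which leaves the left-hand side. -/
theorem stUnit_liftHom_coh (H : A ⟶ S.toWk) {n : ℕ} (q : (Wk P).Cell n) (a : Fin n → A.carrier) :
    S.toWk.actMap (𝟙 q) (fun i => (H.coh (incl P.one) (fun _ => a i)).hom) ≫
      (H.coh q (fun i => A.act (incl P.one) (fun _ => a i))).hom ≫
      H.functor.map ((actUnitIso A q a).hom ≫ (unitIso (A.act q a)).inv) ≫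
        (H.coh (incl P.one) (fun _ => A.act q a)).inv =
      eqToHom (congrArg (S.toWk.act q) (funext fun i => liftObj_unit H (a i))) ≫
        (H.coh q a).hom ≫ eqToHom (liftObj_unit H (A.act q a)).symm := by
  have h := H.coh_natural (𝟙 q) (fun i => (unitIso (a i)).hom)
  have h' : ∀ i, (H.coh (incl P.one) (fun _ => a i)).hom ≫ H.functor.map (unitIso (a i)).hom =
      eqToHom (liftObj_unit H (a i)) := fun i => by
    rw [coh_incl_one, Category.assoc, ← H.functor.map_comp]
    simp
  rw [coh_incl_one_inv, ← H.functor.map_comp_assoc, Category.assoc, Iso.inv_hom_id,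
    Category.comp_id]
  change _ ≫ _ ≫ H.functor.map (A.actMap (𝟙 q) (fun i => (unitIso (a i)).hom)) ≫ _ = _
  rw [← reassoc_of% h, ← Category.assoc, ← Alg.actMap_comp_id, funext h', Alg.actMap_eqToHom]

theorem map_iso_cancel {C : Type w} [Category.{w'} C] {D : Type w₁} [Category.{w₁'} D]
    (F : C ⥤ D) {X Y Z : C} {U V W : D} (u : U ⟶ V) (c : V ⟶ F.obj X) (d : X ≅ Y)
    (e : F.obj Y ≅ W) (s : X ⟶ Z) {W' : D} (k : F.obj Z ⟶ W') :
    (u ≫ (c ≫ F.map d.hom) ≫ e.hom) ≫ (e.inv ≫ F.map (d.inv ≫ s) ≫ k) =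
      u ≫ c ≫ F.map s ≫ k := by
  simp

theorem stUnit_liftHom (H : A ⟶ S.toWk) : stUnit A ≫ liftHom H = H := by
  refine WeakHom.ext_of_hom (CategoryTheory.Functor.ext (fun a => liftObj_unit H a)
    fun a b f => stUnit_liftHom_map H f) fun {n} q a => ?_
  refine (conj_eqToHom_iff_heq (C := S.toWk.carrier) _ _
    (congrArg (S.toWk.act q) (funext fun i => liftObj_unit H (a i)))
    (liftObj_unit H (A.act q a))).1 ?_
  refine Eq.trans ?_ (stUnit_liftHom_coh H q a)
  exact map_iso_cancel H.functor _ _ (delta (q := q) rfl fun i => (stUnitFunctor A).obj (a i)) _ _ _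

end UniversalProperty

/-! ### Uniqueness of the extension, and the adjunction -/

section Uniqueness

variable {P : PlainOperad.{u}} {A : WkPCat.{v, u} P} {S : StrPCat.{v, u} P}

/-- The functor `F'` is full: conjugation with `1_P(a) ≅ a` inverts it on arrows. -/
theorem stUnit_full {a b : A.carrier}
    (g : (stUnit A).functor.obj a ⟶ (stUnit A).functor.obj b) :
    ∃ f : a ⟶ b, (stUnit A).functor.map f = g := by
  change (stUnitFunctor A).obj a ⟶ (stUnitFunctor A).obj b at g
  refine ⟨(unitIso a).inv ≫ g.hom ≫ (unitIso b).hom, InducedCategory.hom_ext ?_⟩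
  change A.actMap (𝟙 (incl P.one)) (fun _ => (unitIso a).inv ≫ g.hom ≫ (unitIso b).hom) = g.hom
  refine (cancel_mono (unitIso b).hom).1 ?_
  rw [unitIso_natural]
  exact Iso.hom_inv_id_assoc _ _

/-- Every object `(p, a₁, …, aₙ)` of `st A` is the value of an operation on objects `(1_P, aᵢ)`. -/
theorem st_exists_act (x : (st A).toWk.carrier) :
    ∃ (n : ℕ) (q : (Wk P).Cell n) (a : Fin n → A.carrier),
      x = (st A).toWk.act q (fun i => (stUnit A).functor.obj (a i)) := by
  obtain ⟨n, p, a⟩ := x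
  refine ⟨n, incl p, a, ?_⟩
  have h := Kel.bind_leaf (ev (incl p)) a
  rw [ev_incl] at h
  refine h.symm.trans ?_
  change _ = Kel.bind (ev (incl p)) _
  rw [ev_incl]
  rfl

theorem WeakHom.IsStrict.obj_act {Q : CatOperad.{w, w'}} {A B : Alg.{v, u} Q} {F : A ⟶ B}
    (hF : WeakHom.IsStrict F) {n : ℕ} (q : Q.Cell n) (a : Fin n → A.carrier) :
    F.functor.obj (A.act q a) = B.act q (fun i => F.functor.obj (a i)) :=
  (hF q a).1.symm

/-- A strict map sends the coherence maps of `E` to those of the composite. -/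
theorem WeakHom.IsStrict.coh_comp_heq {Q : CatOperad.{w, w'}} {A B C : Alg.{v, u} Q} (E : A ⟶ B)
    {F : B ⟶ C} (hF : WeakHom.IsStrict F) {n : ℕ} (q : Q.Cell n) (a : Fin n → A.carrier) :
    HEq ((E ≫ F).coh q a).hom (F.functor.map (E.coh q a).hom) := by
  obtain ⟨h, e⟩ := hF q (fun i => E.functor.obj (a i))
  change HEq ((F.coh q (fun i => E.functor.obj (a i))).hom ≫ F.functor.map (E.coh q a).hom) _
  rw [e]
  exact eqToHom_comp_heq _ _

theorem WeakHom.coh_heq {Q : CatOperad.{w, w'}} {A B : Alg.{v, u} Q} {F G : A ⟶ B}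
    (h : F = G) {n : ℕ} (q : Q.Cell n) (a : Fin n → A.carrier) :
    HEq (F.coh q a).hom (G.coh q a).hom := by
  rw [h]

theorem map_iso_inv_heq {C : Type w} [Category.{w'} C] {D : Type w₁} [Category.{w₁'} D]
    {F G : C ⥤ D} {X Y : C} (e : X ≅ Y) (hX : F.obj X = G.obj X) (hY : F.obj Y = G.obj Y)
    (h : HEq (F.map e.hom) (G.map e.hom)) : HEq (F.map e.inv) (G.map e.inv) := by
  have h' := (conj_eqToHom_iff_heq _ _ hX hY).2 h
  refine (conj_eqToHom_iff_heq _ _ hY hX).1 ?_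
  rw [← cancel_epi (F.map e.hom), ← F.map_comp, e.hom_inv_id, h']
  simp

/-- A strict `P`-functor out of `st A` is determined by its composite with `(F', ψ)`. -/
theorem stUnit_comp_injective {F G : (st A).toWk ⟶ S.toWk} (hF : WeakHom.IsStrict F)
    (hG : WeakHom.IsStrict G) (h : stUnit A ≫ F = stUnit A ≫ G) : F = G := by
  have hu : ∀ a, F.functor.obj ((stUnit A).functor.obj a) =
      G.functor.obj ((stUnit A).functor.obj a) := fun a =>
    congrArg (fun K : A ⟶ S.toWk => K.functor.obj a) h
  have ho : ∀ x, F.functor.obj x = G.functor.obj x := fun x => by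
    obtain ⟨n, q, a, rfl⟩ := st_exists_act x
    rw [hF.obj_act, hG.obj_act]
    exact congrArg (S.toWk.act q) (funext fun i => hu (a i))
  -- `F` and `G` agree on the components of `ψ`
  have hc : ∀ {n : ℕ} (q : (Wk P).Cell n) (a : Fin n → A.carrier),
      HEq (F.functor.map ((stUnit A).coh q a).hom) (G.functor.map ((stUnit A).coh q a).hom) :=
    fun q a => (hF.coh_comp_heq (stUnit A) q a).symm.trans
      ((WeakHom.coh_heq h q a).trans (hG.coh_comp_heq (stUnit A) q a))
  have hm : ∀ {a b : A.carrier} (f : a ⟶ b), HEq (F.functor.map ((stUnit A).functor.map f))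
      (G.functor.map ((stUnit A).functor.map f)) := fun f =>
    congr_arg_heq (fun K : A ⟶ S.toWk => K.functor.map f) h
  have hfun : F.functor = G.functor := by
    refine Functor.hext ho fun x y f => ?_
    obtain ⟨n, q, a, rfl⟩ := st_exists_act x
    obtain ⟨m, r, b, rfl⟩ := st_exists_act y
    obtain ⟨g, hg⟩ := stUnit_full (((stUnit A).coh q a).inv ≫ f ≫ ((stUnit A).coh r b).hom)
    obtain rfl : f = ((stUnit A).coh q a).hom ≫ (stUnit A).functor.map g ≫
        ((stUnit A).coh r b).inv := by
      rw [hg]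
      simp
    exact Functor.map_comp_heq (ho _) (ho _) (ho _) (hc q a)
      (Functor.map_comp_heq (ho _) (ho _) (ho _) (hm g)
        (map_iso_inv_heq _ (ho _) (ho _) (hc r b)))
  -- by strictness, both coherence maps are identities between equal objects
  refine WeakHom.ext_of_hom hfun fun q x => ?_
  obtain ⟨h₁, e₁⟩ := hF q x
  obtain ⟨h₂, e₂⟩ := hG q x
  rw [e₁, e₂]
  refine (conj_eqToHom_iff_heq _ _ (congrArg (S.toWk.act q) (funext fun i => ho (x i)))
    (ho _)).1 ?_
  simp

variable (A S) in
/-- Strict `P`-functors `st A ⟶ S` correspond to weak `P`-functors `A ⟶ U' S`, by composition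
with `(F', ψ)`. -/
def stHomEquiv : (st A ⟶ S) ≃ (A ⟶ S.toWk) where
  toFun K := stUnit A ≫ K.hom
  invFun H := ⟨liftHom H, isStrict_liftHom H⟩
  left_inv K := StrPCat.Hom.ext
    (stUnit_comp_injective (isStrict_liftHom _) K.strict (stUnit_liftHom _))
  right_inv H := stUnit_liftHom H

variable (P) in
/-- Strictification as a functor: the left adjoint determined by `stHomEquiv`. -/
abbrev stFunctor : WkPCat.{v, u} P ⥤ StrPCat.{v, u} P :=
  Adjunction.leftAdjointOfEquiv (G := forgetStr P) (F_obj := st) stHomEquiv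
    fun A _ _ G K => (Category.assoc (stUnit A) K.hom G.hom).symm

end Uniqueness

/-! ### The equivalence between a weak category and its strictification -/

section Equivalence

/-- Isomorphisms `F a ≅ G a`, natural in `a` and compatible with the coherence maps, form an
isomorphism of weak maps. -/
def WeakHom.isoOfComponents {Q : CatOperad.{w, w'}} {A B : Alg.{v, u} Q} {F G : A ⟶ B}
    (e : ∀ a, F.functor.obj a ≅ G.functor.obj a)
    (nat : ∀ {a b : A.carrier} (f : a ⟶ b),
      F.functor.map f ≫ (e b).hom = (e a).hom ≫ G.functor.map f)
    (comm : ∀ {n : ℕ} (q : Q.Cell n) (a : Fin n → A.carrier),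
      (F.coh q a).hom ≫ (e (A.act q a)).hom =
        B.actMap (𝟙 q) (fun i => (e (a i)).hom) ≫ (G.coh q a).hom) : F ≅ G where
  hom :=
    { nat := (NatIso.ofComponents e nat).hom
      comm := comm }
  inv :=
    { nat := (NatIso.ofComponents e nat).inv
      comm := fun q a => by
        have h : B.actMap (𝟙 q) (fun i => (e (a i)).inv) ≫
            B.actMap (𝟙 q) (fun i => (e (a i)).hom) = 𝟙 _ :=
          (B.actIso q fun i => e (a i)).inv_hom_id
        change (G.coh q a).hom ≫ (e (A.act q a)).inv =
          B.actMap (𝟙 q) (fun i => (e (a i)).inv) ≫ (F.coh q a).hom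
        rw [Iso.comp_inv_eq, Category.assoc, comm, reassoc_of% h] }
  hom_inv_id := Trans.hom_ext fun a => (e a).hom_inv_id
  inv_hom_id := Trans.hom_ext fun a => (e a).inv_hom_id

theorem inv_comp_cancel {C : Type w} [Category.{w'} C] {X Y Z W : C} (d : X ≅ Y) (e : X ≅ Z)
    (f : Z ⟶ W) : 𝟙 Z ≫ f = e.inv ≫ d.hom ≫ d.inv ≫ e.hom ≫ f := by
  simp

theorem comp_cancel_of_eq {C : Type w} [Category.{w'} C] {X Y Z Z' V W : C} (d : X ≅ Y)
    (e : Z' ≅ Z) {f : X ⟶ Z} {g : Z ⟶ W} {h : Y ⟶ W} {m : Z' ⟶ V} {n : V ⟶ W}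
    (h₁ : f ≫ g = d.hom ≫ h) (h₂ : m ≫ n = e.hom ≫ g) :
    ((d.inv ≫ f ≫ e.inv) ≫ m) ≫ n = h ≫ 𝟙 W := by
  simp only [Category.assoc, h₂, Iso.inv_hom_id_assoc, h₁, Category.comp_id]

variable {P : PlainOperad.{u}} (A : WkPCat.{v, u} P)

/-- The isomorphisms `a ≅ 1_P(a)` form an invertible transformation from the identity to the
composite `A ⟶ st A ⟶ A`. -/
def stUnitEvalIso : 𝟙 A ≅ stUnit A ≫ stEval A :=
  WeakHom.isoOfComponents (fun a => (unitIso a).symm)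
    (fun {a b} f => by
      change f ≫ (unitIso b).inv = (unitIso a).inv ≫ A.actMap (𝟙 (incl P.one)) (fun _ => f)
      rw [Iso.comp_inv_eq, Category.assoc, unitIso_natural, Iso.inv_hom_id_assoc])
    (fun q a => inv_comp_cancel (delta (q := q) rfl fun i => (stUnitFunctor A).obj (a i))
      (actUnitIso A q a) (unitIso (A.act q a)).inv)

/-- The isomorphisms `(1_P, p(a₁, …, aₙ)) ≅ (p, a₁, …, aₙ)` form an invertible transformation from
the composite `st A ⟶ A ⟶ st A` to the identity. -/
def stEvalUnitIso : stEval A ≫ stUnit A ≅ 𝟙 (st A).toWk :=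
  WeakHom.isoOfComponents (fun x => InducedCategory.isoMk (unitIso (realize A x)))
    (fun f => InducedCategory.hom_ext (unitIso_natural f.hom _))
    (fun q x => InducedCategory.hom_ext (comp_cancel_of_eq
      (delta (q := q) rfl fun i => (stUnitFunctor A).obj (realize A (x i)))
      (unitIso (A.act q fun i => realize A (x i)))
      (delta_natural (A := A) (q := q) (q' := q) rfl rfl (𝟙 q) _
        (x := fun i => (stUnitFunctor A).obj (realize A (x i))) (x' := x)
        (fun i => (unitIso (realize A (x i))).hom))
      (unitIso_natural (delta (q := q) rfl x).hom (𝟙 (incl P.one)))))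

/-- The adjoint equivalence between `A` and `U' (st A)` formed by `(F', ψ)` and `(F, φ)`. The counit
is `stEvalUnitIso A` corrected so that the triangle identities hold. -/
def stEquivalence : Bicategory.Equivalence A (st A).toWk :=
  Bicategory.Equivalence.mkOfAdjointifyCounit (stUnitEvalIso A) (stEvalUnitIso A)

end Equivalence

/-! ### Weak coreflectivity -/

section Inclusion

variable {P : PlainOperad.{u}}

/-- A strict `P`-category is determined by its restriction along evaluation, because evaluation is
surjective on 1-cells and on 2-cells. -/
theorem StrPCat.toWk_injective : Function.Injective (StrPCat.toWk (P := P) :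
    StrPCat.{v, u} P → WkPCat.{v, u} P) := by
  have hsurj : ∀ {n : ℕ} (p : (Disc P).Cell n), ∃ t : (Wk P).Cell n,
      ((evalHom P).level n).obj t = p := fun p =>
    ⟨incl p.as, congrArg Discrete.mk (ev_incl p.as)⟩
  rintro ⟨⟨C, act, actMap, _, _, _, _, _, _⟩⟩ ⟨⟨C', act', actMap', _, _, _, _, _, _⟩⟩ h
  simp only [StrPCat.toWk, Alg.restrict, Alg.mk.injEq] at h
  obtain ⟨rfl, h⟩ := h
  simp only [heq_eq_eq] at h
  obtain ⟨rfl, h⟩ := h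
  obtain ⟨hact, h⟩ := h
  obtain rfl : @act = @act' := by
    funext n p a
    obtain ⟨t, rfl⟩ := hsurj p
    exact congrFun (congrFun (congrFun hact n) t) a
  obtain rfl : @actMap = @actMap' := by
    funext n p p' a a' f g
    obtain ⟨t, rfl⟩ := hsurj p
    obtain ⟨t', rfl⟩ := hsurj p'
    obtain ⟨f', rfl⟩ : ∃ f' : t ⟶ t', ((evalHom P).level n).map f' = f :=
      ⟨PLift.up (Discrete.eq_of_hom f),
        Subsingleton.elim (α := Discrete.mk _ ⟶ Discrete.mk _) _ _⟩
    exact congrFun (congrFun (congrFun (congrFun (congrFun (congrFun (congrFun (eq_of_heq h)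
      n) t) t') a) a') f') g
  rfl

variable (P)

/-- Strictification is left adjoint to the inclusion of strict `P`-categories. -/
abbrev stAdjunction : stFunctor.{v, u} P ⊣ forgetStr.{v, u} P :=
  Adjunction.adjunctionOfEquivLeft (G := forgetStr P) (F_obj := st) stHomEquiv _

theorem stAdjunction_unit (A : WkPCat.{v, u} P) : (stAdjunction P).unit.app A = stUnit A :=
  Category.comp_id (stUnit A)

theorem isWeaklyCoreflective_inclusion : IsWeaklyCoreflective (inclusion.{v, u} P) where
  obj_injective := StrPCat.toWk_injective
  map_injective _ _ _ _ h := StrPCat.Hom.ext h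
  map₂_injective _ _ _ _ _ _ h := StrPCat.hom₂_ext h
  exists_leftAdjoint := ⟨stFunctor P, stAdjunction P,
    fun A => ⟨stEquivalence A, (stAdjunction_unit P A).symm⟩⟩

end Inclusion

end OperadCoherence

theorem mainTheorem2 (P : OperadCoherence.PlainOperad.{u}) :
    (∃ (stMap : ∀ {A B : OperadCoherence.WkPCat.{v, u} P},
          (A ⟶ B) → (OperadCoherence.st A ⟶ OperadCoherence.st B))
        (stMap_id : ∀ A : OperadCoherence.WkPCat.{v, u} P,
          stMap (𝟙 A) = 𝟙 (OperadCoherence.st A))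
        (stMap_comp : ∀ {A B C : OperadCoherence.WkPCat.{v, u} P} (F : A ⟶ B) (G : B ⟶ C),
          stMap (F ≫ G) = stMap F ≫ stMap G)
        (adj : ({ obj := OperadCoherence.st
                  map := stMap
                  map_id := stMap_id
                  map_comp := stMap_comp } :
              OperadCoherence.WkPCat.{v, u} P ⥤ OperadCoherence.StrPCat.{v, u} P) ⊣
            OperadCoherence.forgetStr P),
        ∀ A : OperadCoherence.WkPCat.{v, u} P, adj.unit.app A = OperadCoherence.stUnit A) ∧
    (∀ A : OperadCoherence.WkPCat.{v, u} P,
      ∃ e : Bicategory.Equivalence A (OperadCoherence.st A).toWk,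
        e.hom = OperadCoherence.stUnit A ∧ e.inv = OperadCoherence.stEval A) ∧
    OperadCoherence.IsWeaklyCoreflective (OperadCoherence.inclusion.{v, u} P) := by
  refine ⟨⟨(OperadCoherence.stFunctor P).map, (OperadCoherence.stFunctor P).map_id,
    (OperadCoherence.stFunctor P).map_comp, OperadCoherence.stAdjunction P,
    OperadCoherence.stAdjunction_unit P⟩,
    fun A => ⟨OperadCoherence.stEquivalence A, rfl, rfl⟩,
    OperadCoherence.isWeaklyCoreflective_inclusion P⟩
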